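/- There is an absolute constant $C>0$ such that the following holds. Let $\mathcal H$ be a finite-dimensional complex Hilbert space, let $U$ be a unitary on $\mathcal H$, let $\Pi,\widetilde\Pi$ be orthogonal projectors on $\mathcal H$, and let $\delta>0$ and $\varepsilon\in(0,\tfrac12)$. Let $\widetilde\Pi U\Pi=W\Sigma V^\dagger$ be a singular value decomposition, i.e. $W,V$ are unitary and $\Sigma=\mathrm{diag}(\varsigma_1,\dots,\varsigma_n)$, $n=\dim\mathcal H$, with $\varsigma_1\ge\dots\ge\varsigma_n\ge 0$. Let $\Sigma_{\ge\delta}$ be the diagonal matrix with entry $1$ where $\varsigma_i\ge\delta$ and $0$ elsewhere, and put $\Pi_{\ge\delta}:=\Pi V\Sigma_{\ge\delta}V^\dagger\Pi$ and $\widetilde\Pi_{\ge\delta}:=\widetilde\Pi W\Sigma_{\ge\delta}W^\dagger\widetilde\Pi$. For $\Phi=(\phi_1,\dots,\phi_m)\in\mathbb R^m$ let $$U_\Phi:=\begin{cases} e^{i\phi_1(2\widetilde\Pi-I)}U\prod_{j=1}^{(m-1)/2}\left(e^{i\phi_{2j}(2\Pi-I)}U^\dagger e^{i\phi_{2j+1}(2\widetilde\Pi-I)}U\right)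 & m \text{ odd},\\ \prod_{j=1}^{m/2}\left(e^{i\phi_{2j-1}(2\Pi-I)}U^\dagger e^{i\phi_{2j}(2\widetilde\Pi-I)}U\right) & m\text{ even.}\end{cases}$$ Then there are a non-negative integer $m\le C\,\frac{\log(1/\varepsilon)}{\delta}$ and a $\Phi\in\mathbb R^m$ such that, in operator norm, $$\left\|\widetilde\Pi_{\ge\delta}\,U_\Phi\,\Pi_{\ge\delta}-\widetilde\Pi_{\ge\delta}\,(WV^\dagger)\,\Pi_{\ge\delta}\right\|\le\varepsilon .$$ Moreover, $U_\Phi$ can be implemented by a circuit with a single ancilla qubit (which starts in $|0\rangle$ and is returned to $|0\rangle$) that uses $U$ and $U^\dagger$ exactly $m$ times in total, $m$ single-qubit gates on the ancilla, at most $m$ $\mathrm{C}_{\Pi}\mathrm{NOT}$ gates and at most $m$ $\mathrm{C}_{\widetilde\Pi}\mathrm{NOT}$ gates, where $\mathrm{C}_\Pi\mathrm{NOT}:=X\otimes\Pi+I\otimes(I-\Pi)$ and likewise for $\widetilde\Pi$. -/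

import Mathlib

open scoped TensorProduct

noncomputable section

/-- The phase operator `e^{iφ(2P - I)}` of an orthogonal projector `P`. -/
def phaseOp {H : Type*} [NormedAddCommGroup H] [InnerProductSpace ℂ H]
    (P : H →L[ℂ] H) (φ : ℝ) : H →L[ℂ] H :=
  NormedSpace.exp ((Complex.I * (φ : ℂ)) • ((2 : ℂ) • P - 1))

/-- The phased alternating sequence `U_Φ` of a unitary `U` and orthogonal projectors `P`, `Q`
(`Q` is the projector written with a tilde). With `Φ = (φ_1, …, φ_n)`, it is
`e^{iφ_1(2Q-I)} U ∏_{j=1}^{(n-1)/2} (e^{iφ_{2j}(2P-I)} U† e^{iφ_{2j+1}(2Q-I)} U)` for odd `n` and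
`∏_{j=1}^{n/2} (e^{iφ_{2j-1}(2P-I)} U† e^{iφ_{2j}(2Q-I)} U)` for even `n`.
In both cases it is an ordered product of `n` factors, alternately of the
form `e^{iφ(2Q-I)} U` and `e^{iφ(2P-I)} U†`, whose last (rightmost) factor
is `e^{iφ_n(2Q-I)} U`. Here the phases are indexed from `0`. -/
def phasedSeq {H : Type*} [NormedAddCommGroup H] [InnerProductSpace ℂ H] [CompleteSpace H]
    (U P Q : H →L[ℂ] H) {n : ℕ} (Φ : Fin n → ℝ) : H →L[ℂ] H :=
  (List.ofFn fun j : Fin n =>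
    if Odd (n - (j : ℕ)) then phaseOp Q (Φ j) * U else phaseOp P (Φ j) * star U).prod

/-- The diagonal operator on `ℂⁿ` with diagonal entries `a`. -/
def diagOp {n : ℕ} (a : Fin n → ℂ) :
    EuclideanSpace ℂ (Fin n) →L[ℂ] EuclideanSpace ℂ (Fin n) :=
  Matrix.toEuclideanCLM (𝕜 := ℂ) (Matrix.diagonal a)

/-- The operator `W D V†` on `H`, for unitary maps `W V : ℂⁿ → H`
(whose columns are the images of the standard basis vectors) and an operator `D` on `ℂⁿ`. -/
def conjOp {H : Type*} [NormedAddCommGroup H] [InnerProductSpace ℂ H] {n : ℕ}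
    (W : EuclideanSpace ℂ (Fin n) ≃ₗᵢ[ℂ] H)
    (D : EuclideanSpace ℂ (Fin n) →L[ℂ] EuclideanSpace ℂ (Fin n))
    (V : EuclideanSpace ℂ (Fin n) ≃ₗᵢ[ℂ] H) : H →L[ℂ] H :=
  (W.toContinuousLinearEquiv : EuclideanSpace ℂ (Fin n) →L[ℂ] H) ∘L D ∘L
    (V.symm.toContinuousLinearEquiv : H →L[ℂ] EuclideanSpace ℂ (Fin n))

/-- `A = W Σ V†` is a singular value decomposition of `A`: `W` and `V` are unitary and
`Σ = diag(σ_1, …, σ_n)` with non-negative, non-increasing diagonal entries. -/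
structure IsSVD {H : Type*} [NormedAddCommGroup H] [InnerProductSpace ℂ H] {n : ℕ}
    (A : H →L[ℂ] H) (W : EuclideanSpace ℂ (Fin n) ≃ₗᵢ[ℂ] H) (σ : Fin n → ℝ)
    (V : EuclideanSpace ℂ (Fin n) ≃ₗᵢ[ℂ] H) : Prop where
  nonneg : ∀ i, 0 ≤ σ i
  antitone : Antitone σ
  eq : A = conjOp W (diagOp fun i => (σ i : ℂ)) V

/-- `Σ_S`: the diagonal operator obtained from `Σ = diag(σ)` by replacing the singular values
that lie in `S` by `1` and all others by `0`. -/
def sigmaSet {n : ℕ} (σ : Fin n → ℝ) (S : Set ℝ) :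
    EuclideanSpace ℂ (Fin n) →L[ℂ] EuclideanSpace ℂ (Fin n) :=
  diagOp fun i => S.indicator (fun _ => (1 : ℂ)) (σ i)

/-- The singular value threshold projector `P V Σ_S V† P`. With the projector `P` and the right
singular vectors `V` this is the right one; with the other projector `Q` and the left
singular vectors `W` it is the left one, `Q W Σ_S W† Q`. -/
def threshProj {H : Type*} [NormedAddCommGroup H] [InnerProductSpace ℂ H] {n : ℕ}
    (P : H →L[ℂ] H) (V : EuclideanSpace ℂ (Fin n) ≃ₗᵢ[ℂ] H) (σ : Fin n → ℝ) (S : Set ℝ) :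
    H →L[ℂ] H :=
  P * conjOp V (sigmaSet σ S) V * P

/-- A qubit. -/
abbrev Qubit : Type := EuclideanSpace ℂ (Fin 2)

/-- The computational basis state `|0⟩` of a qubit. -/
def ket0 : Qubit := EuclideanSpace.single 0 1

/-- The gate `C_P NOT = X ⊗ P + I ⊗ (I - P)` on `ℂ² ⊗ H`. -/
def cProjNot {H : Type*} [NormedAddCommGroup H] [InnerProductSpace ℂ H]
    (P : H →L[ℂ] H) : Qubit ⊗[ℂ] H →ₗ[ℂ] Qubit ⊗[ℂ] H :=
  TensorProduct.map (Matrix.toEuclideanLin !![(0 : ℂ), 1; 1, 0]) (P : H →ₗ[ℂ] H) +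
    TensorProduct.map LinearMap.id ((1 - P : H →L[ℂ] H) : H →ₗ[ℂ] H)

/-- The gates of a circuit on one ancilla qubit and the register `H`. -/
inductive Gate : Type
  /-- the unitary `U` on the register -/
  | applyU : Gate
  /-- its inverse `U†` on the register -/
  | applyUdag : Gate
  /-- `C_P NOT` -/
  | cNotP : Gate
  /-- `C_Q NOT` -/
  | cNotQ : Gate
  /-- a single-qubit gate on the ancilla -/
  | single (u : Matrix.unitaryGroup (Fin 2) ℂ) : Gate

/-- The operator on `ℂ² ⊗ H` (ancilla first) that a gate implements. -/
def Gate.op {H : Type*} [NormedAddCommGroup H] [InnerProductSpace ℂ H] [CompleteSpace H]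
    (U P Q : H →L[ℂ] H) : Gate → (Qubit ⊗[ℂ] H →ₗ[ℂ] Qubit ⊗[ℂ] H)
  | .applyU => TensorProduct.map LinearMap.id (U : H →ₗ[ℂ] H)
  | .applyUdag => TensorProduct.map LinearMap.id ((star U : H →L[ℂ] H) : H →ₗ[ℂ] H)
  | .cNotP => cProjNot P
  | .cNotQ => cProjNot Q
  | .single u => TensorProduct.map (Matrix.toEuclideanLin (u : Matrix (Fin 2) (Fin 2) ℂ))
      LinearMap.id

/-- Number of uses of `U` or `U†` in a gate. -/
def Gate.usesU : Gate → ℕ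
  | .applyU => 1
  | .applyUdag => 1
  | _ => 0

/-- Number of uses of `C_P NOT` in a gate. -/
def Gate.usesCP : Gate → ℕ
  | .cNotP => 1
  | _ => 0

/-- Number of uses of `C_Q NOT` in a gate. -/
def Gate.usesCQ : Gate → ℕ
  | .cNotQ => 1
  | _ => 0

/-- Number of uses of single-qubit gates in a gate. -/
def Gate.usesSingle : Gate → ℕ
  | .single _ => 1
  | _ => 0

/-- The operator of a circuit, written as a product of gates: the last gate of the list is
applied first. -/
def circuitOp {H : Type*} [NormedAddCommGroup H] [InnerProductSpace ℂ H] [CompleteSpace H]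
    (U P Q : H →L[ℂ] H) (c : List Gate) : Qubit ⊗[ℂ] H →ₗ[ℂ] Qubit ⊗[ℂ] H :=
  ((c.map (Gate.op U P Q)).prod : Module.End ℂ (Qubit ⊗[ℂ] H))

/-- The circuit `c` implements `T` using a single ancilla qubit, which starts in the
state `|0⟩` and is returned in that state. -/
def Implements {H : Type*} [NormedAddCommGroup H] [InnerProductSpace ℂ H] [CompleteSpace H]
    (U P Q : H →L[ℂ] H) (c : List Gate) (T : H →L[ℂ] H) : Prop :=
  ∀ ψ : H, circuitOp U P Q c (ket0 ⊗ₜ[ℂ] ψ) = ket0 ⊗ₜ[ℂ] T ψ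

end

/-! Let `v`, `w` be a right and a left singular vector with singular value `x > 0`. Then `P v = v`,
`Q w = w`, and `U`, `U†` exchange the spans of `v, U†w` and of `w, Uv`, which the phase operators
preserve. The phased sequence therefore acts there through two amplitudes that depend only on `x`
and the phases (`qsvAmp`). For an odd number of phases `Q` kills the second one, so the compressed
operator is `W diag(A(σ_i)) V†` restricted to `σ_i ≥ δ`, where `A` is the first amplitude. The task
is to find `O(log(1/ε)/δ)` phases with `|A - 1| ≤ ε` on `[δ, 1]`.

Since `|A| ≤ 1`, the bound `Re A ≥ 1 - ε²/2` suffices; the imaginary part is left free, and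
replacing `ε` by `ε²/2` changes the degree only by a constant factor.

Every odd polynomial `x G(x²)` with values in `[0, 1]` on `[0, 1]` is such a real part. With `x =
cos θ` it is, up to a power of `e^{iθ}`, a polynomial `p` in `e^{2iθ}`. Fejér–Riesz
(`exists_spectral_factor`) supplies `h` with `|p|² + |h|² = 1` on the circle, and phases are read
off by lowering the degree of the pair by one at a time (`exists_phases_of_normSq_add_eq_one`).

The polynomial (`exists_sign_poly`) is a composition. A normalised integral of `(sin(N arcsin
x)/x)²` with `N` of order `1/δ` has most of its mass near `0`, so it exceeds `1/2` on `[δ, 1]`. A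
normalised integral of `(1 - x²)^k` with `k` of order `log(1/ε)` moves `[1/2, 1]` close to `1`. The
degrees multiply.

Each phase operator is a `Z` rotation between two projector-controlled NOTs. Making the first phase
zero removes the one pair that would exceed the gate count. -/

/-! ### Polynomial approximation of the sign function -/

open Polynomial in
theorem exists_sin_odd_multiple_poly (r : ℕ) :
    ∃ E : ℝ[X], E.natDegree ≤ r ∧
      ∀ θ : ℝ, Real.sin ((2 * r + 1) * θ) = Real.sin θ * E.eval (Real.sin θ ^ 2) := by
  induction r using Nat.twoStepInduction with
  | zero => exact ⟨1, by simp, fun θ => by simp⟩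
  | one =>
    refine ⟨3 - 4 * X, by compute_degree, fun θ => ?_⟩
    have := Real.sin_three_mul θ
    norm_num [this]
    ring
  | more r ih0 ih1 =>
    obtain ⟨E, hE, h0⟩ := ih0
    obtain ⟨F, hF, h1⟩ := ih1
    refine ⟨(2 - 4 * X) * F - E, ?_, fun θ => ?_⟩
    · refine (natDegree_sub_le _ _).trans (max_le ?_ (by omega))
      refine natDegree_mul_le.trans ?_
      have : (2 - 4 * X : ℝ[X]).natDegree ≤ 1 := by compute_degree
      omega
    · have key : Real.sin ((2 * (r + 2 : ℕ) + 1) * θ) =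
          2 * Real.cos (2 * θ) * Real.sin ((2 * (r + 1 : ℕ) + 1) * θ)
            - Real.sin ((2 * r + 1) * θ) := by
        have e1 : (2 * ((r + 2 : ℕ) : ℝ) + 1) * θ = (2 * ((r + 1 : ℕ) : ℝ) + 1) * θ + 2 * θ := by
          push_cast; ring
        have e2 : (2 * (r : ℝ) + 1) * θ = (2 * ((r + 1 : ℕ) : ℝ) + 1) * θ - 2 * θ := by
          push_cast; ring
        rw [e1, e2, Real.sin_add, Real.sin_sub]
        ring
      have hc : Real.cos (2 * θ) = 1 - 2 * Real.sin θ ^ 2 := by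
        rw [Real.cos_two_mul, Real.cos_sq']; ring
      rw [key, h0, h1, hc]
      simp
      ring

-- Both approximants are normalised antiderivatives of even polynomials that are non-negative on
-- `[0, 1]`: this makes them odd and monotone there.
open Polynomial in
theorem exists_odd_antiderivative (g : ℝ[X]) :
    ∃ G : ℝ[X], G.natDegree ≤ g.natDegree ∧
      ∀ x : ℝ, HasDerivAt (fun x : ℝ => x * G.eval (x ^ 2)) (g.eval (x ^ 2)) x := by
  refine ⟨∑ i ∈ Finset.range (g.natDegree + 1), C (g.coeff i / (2 * i + 1)) * X ^ i, ?_, ?_⟩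
  · refine natDegree_sum_le_of_forall_le _ _ fun i hi => ?_
    exact (natDegree_C_mul_X_pow_le _ _).trans (by simpa [Nat.lt_succ_iff] using hi)
  · intro x
    have h1 : (fun x : ℝ => x * (∑ i ∈ Finset.range (g.natDegree + 1),
        C (g.coeff i / (2 * i + 1)) * X ^ i).eval (x ^ 2)) =
        fun x : ℝ => ∑ i ∈ Finset.range (g.natDegree + 1),
          g.coeff i / (2 * i + 1) * x ^ (2 * i + 1) := by
      funext x
      rw [eval_finsetSum, Finset.mul_sum]
      refine Finset.sum_congr rfl fun i _ => ?_
      simp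
      ring
    rw [h1, eval_eq_sum_range]
    refine HasDerivAt.fun_sum fun i _ => ?_
    refine ((hasDerivAt_pow (2 * i + 1) x).const_mul (g.coeff i / (2 * i + 1))).congr_deriv ?_
    have : (2 * (i : ℝ) + 1) ≠ 0 := by positivity
    rw [← mul_assoc, Nat.cast_add_one, Nat.cast_mul, Nat.cast_two, div_mul_cancel₀ _ this,
      Nat.add_sub_cancel, pow_mul]

open Polynomial in
/-- A polynomial `x G(x²)` that maps `[0, 1]` to itself and `[δ, 1]` to `[1/2, 1]`. -/
theorem exists_coarse_sign_poly (r : ℕ) (δ : ℝ) (hδ : 0 < δ) (hδ1 : δ ≤ 1)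
    (hr : 5 ≤ (2 * r + 1) * δ) :
    ∃ G : ℝ[X], G.natDegree ≤ 2 * r ∧
      (∀ x : ℝ, 0 ≤ x → x ≤ 1 → 0 ≤ x * G.eval (x ^ 2) ∧ x * G.eval (x ^ 2) ≤ 1) ∧
      ∀ x : ℝ, δ ≤ x → x ≤ 1 → 1 / 2 ≤ x * G.eval (x ^ 2) := by
  obtain ⟨E, hE, hsin⟩ := exists_sin_odd_multiple_poly r
  obtain ⟨G, hG, hder⟩ := exists_odd_antiderivative (E ^ 2)
  set N : ℝ := 2 * r + 1 with hN
  have hN1 : 1 ≤ N := by rw [hN]; have : (0 : ℝ) ≤ r := by positivity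
                         linarith
  have hN0 : 0 < N := by linarith
  -- For `0 < x ≤ 1` the derivative of `q` is `(sin(N arcsin x)/x)²`.
  set q : ℝ → ℝ := fun x => x * G.eval (x ^ 2) with hq
  have hq0 : q 0 = 0 := by simp [hq]
  have hcont : Continuous q := by rw [hq]; fun_prop
  have hmono : Monotone q := monotone_of_hasDerivAt_nonneg hder fun x => by
    simpa using sq_nonneg _
  have hsin' : ∀ t : ℝ, 0 ≤ t → t ≤ 1 →
      Real.sin (N * Real.arcsin t) = t * E.eval (t ^ 2) := fun t h0 h1 => by
    have := hsin (Real.arcsin t)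
    rwa [Real.sin_arcsin (by linarith) h1] at this
  -- Mass near zero: on `(0, 1/N)` one has `N arcsin t ≤ π/2`, so Jordan's inequality gives `sin(N
  -- arcsin t) ≥ (2/π) N t`.
  have hlow : 4 / Real.pi ^ 2 * N ≤ q (1 / N) := by
    have hp : 0 < 1 / N := by positivity
    have hbd : ∀ t ∈ Set.Ioo (0 : ℝ) (1 / N), 4 / Real.pi ^ 2 * N ^ 2 ≤ (E ^ 2).eval (t ^ 2) := by
      rintro t ⟨ht0, ht1⟩
      have h1N : 1 / N ≤ 1 := by rw [div_le_one hN0]; exact hN1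
      have ht : t ≤ 1 := by linarith
      have hs := hsin' t ht0.le ht
      have ha0 : 0 ≤ Real.arcsin t := Real.arcsin_nonneg.2 ht0.le
      have ha1 : Real.arcsin t ≤ Real.pi / 2 := Real.arcsin_le_pi_div_two t
      have h2 : 2 / Real.pi * Real.arcsin t ≤ t := by
        have := Real.mul_le_sin ha0 ha1
        rwa [Real.sin_arcsin (by linarith) ht] at this
      have hta : t ≤ Real.arcsin t := by
        have := Real.sin_le ha0
        rwa [Real.sin_arcsin (by linarith) ht] at this
      have h3 : N * Real.arcsin t ≤ Real.pi / 2 := by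
        have hNt : N * t ≤ 1 := by
          have := mul_le_mul_of_nonneg_left ht1.le hN0.le
          rwa [mul_one_div_cancel hN0.ne'] at this
        have : N * Real.arcsin t * (2 / Real.pi) ≤ 1 := by
          calc _ = N * (2 / Real.pi * Real.arcsin t) := by ring
            _ ≤ N * t := by gcongr
            _ ≤ 1 := hNt
        have hpi := Real.pi_pos
        rw [mul_div_assoc', div_le_one hpi] at this
        linarith
      have h4 : 2 / Real.pi * (N * Real.arcsin t) ≤ t * E.eval (t ^ 2) := by
        rw [← hs]; exact Real.mul_le_sin (by positivity) h3
      have h5 : 2 / Real.pi * N ≤ E.eval (t ^ 2) := by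
        have : t * (2 / Real.pi * N) ≤ t * E.eval (t ^ 2) := by
          refine le_trans ?_ h4
          calc t * (2 / Real.pi * N) = 2 / Real.pi * (N * t) := by ring
            _ ≤ _ := by have := Real.pi_pos; gcongr
        exact le_of_mul_le_mul_left this ht0
      calc 4 / Real.pi ^ 2 * N ^ 2 = (2 / Real.pi * N) ^ 2 := by ring
        _ ≤ E.eval (t ^ 2) ^ 2 := by
          have := Real.pi_pos
          gcongr
        _ = _ := by simp
    obtain ⟨c, hc, hce⟩ := exists_hasDerivAt_eq_slope q (fun x => (E ^ 2).eval (x ^ 2)) hp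
      hcont.continuousOn fun x _ => hder x
    have := hbd c hc
    rw [hce, hq0, sub_zero, sub_zero, le_div_iff₀ hp] at this
    calc 4 / Real.pi ^ 2 * N = 4 / Real.pi ^ 2 * N ^ 2 * (1 / N) := by field_simp
      _ ≤ _ := this
  -- Tail: the derivative is at most `1/x²`, whose integral over `[δ, 1]` is below `1/δ`.
  have hup : q 1 - q δ ≤ 1 / δ := by
    have hanti : AntitoneOn (fun t => q t + t⁻¹) (Set.Icc δ 1) := by
      refine antitoneOn_of_deriv_nonpos (convex_Icc _ _) ?_ ?_ ?_
      · refine hcont.continuousOn.add (continuousOn_id.inv₀ fun x hx => ?_)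
        exact (hδ.trans_le hx.1).ne'
      · intro x hx
        rw [interior_Icc] at hx
        exact ((hder x).add (hasDerivAt_inv (hδ.trans hx.1).ne')).differentiableAt.differentiableWithinAt
      · intro x hx
        rw [interior_Icc] at hx
        have hx0 := hδ.trans hx.1
        have hd : HasDerivAt (fun t => q t + t⁻¹) _ x :=
          (hder x).add (hasDerivAt_inv (hδ.trans hx.1).ne')
        rw [hd.deriv]
        have hs := hsin' x hx0.le hx.2.le
        have h1 : (x * E.eval (x ^ 2)) ^ 2 ≤ 1 := by
          rw [← hs]; exact Real.sin_sq_le_one _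
        have h2 : E.eval (x ^ 2) ^ 2 ≤ (x ^ 2)⁻¹ := by
          rw [mul_pow] at h1
          rw [← one_div, le_div_iff₀ (by positivity)]
          linarith
        simpa using h2
    have := hanti (Set.left_mem_Icc.2 hδ1) (Set.right_mem_Icc.2 hδ1) hδ1
    simp only [inv_one] at this
    rw [one_div]; linarith
  have hpi2 : Real.pi ^ 2 < 10 := by
    have := Real.pi_lt_d2
    have := Real.pi_pos
    nlinarith
  have hq1 : 4 / Real.pi ^ 2 * N ≤ q 1 := hlow.trans (hmono (by rw [div_le_one hN0]; exact hN1))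
  -- From `N δ ≥ 5` and `π² < 10`. The tail is then at most half of `q 1`.
  have hq1' : 2 / δ ≤ q 1 := by
    refine le_trans ?_ hq1
    have := Real.pi_pos
    rw [div_le_iff₀ hδ, div_mul_eq_mul_div, div_mul_eq_mul_div, le_div_iff₀ (by positivity)]
    nlinarith
  have hq1pos : 0 < q 1 := lt_of_lt_of_le (by positivity) hq1'
  have hev : ∀ x : ℝ, x * (C (q 1)⁻¹ * G).eval (x ^ 2) = q x / q 1 := fun x => by
    simp only [eval_mul, eval_C, hq]; ring
  refine ⟨C (q 1)⁻¹ * G, ?_, fun x h0 h1 => ?_, fun x h0 h1 => ?_⟩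
  · refine (natDegree_C_mul_le _ _).trans (hG.trans (natDegree_pow_le.trans ?_))
    omega
  · rw [hev]
    refine ⟨div_nonneg (hq0 ▸ hmono h0) hq1pos.le, ?_⟩
    rw [div_le_one hq1pos]; exact hmono h1
  · rw [hev, le_div_iff₀ hq1pos]
    have h2 := hmono h0
    have : 2 / δ = 2 * (1 / δ) := by ring
    linarith

open Polynomial in
/-- A polynomial `x G(x²)` that maps `[0, 1]` to itself and is close to `1` on `[1/2, 1]`. -/
theorem exists_amplifying_poly (k : ℕ) :
    ∃ G : ℝ[X], G.natDegree ≤ k ∧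
      (∀ x : ℝ, 0 ≤ x → x ≤ 1 → 0 ≤ x * G.eval (x ^ 2) ∧ x * G.eval (x ^ 2) ≤ 1) ∧
      ∀ x : ℝ, 1 / 2 ≤ x → x ≤ 1 → 1 - (k + 1) * (3 / 4) ^ k / 2 ≤ x * G.eval (x ^ 2) := by
  obtain ⟨G, hG, hder⟩ := exists_odd_antiderivative ((1 - X) ^ k)
  set q : ℝ → ℝ := fun x => x * G.eval (x ^ 2) with hq
  have hder' : ∀ x, HasDerivAt q ((1 - x ^ 2) ^ k) x := fun x => by simpa using hder x
  have hq0 : q 0 = 0 := by simp [hq]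
  have hcont : Continuous q := by rw [hq]; fun_prop
  have hmono : MonotoneOn q (Set.Icc 0 1) := by
    refine monotoneOn_of_deriv_nonneg (convex_Icc _ _) hcont.continuousOn
      (fun x _ => (hder' x).differentiableAt.differentiableWithinAt) fun x hx => ?_
    rw [interior_Icc] at hx
    rw [(hder' x).deriv]
    exact pow_nonneg (by nlinarith [hx.1, hx.2]) _
  -- Comparison of `(1 - x²)^k` with `(1 - x)^k`, whose integral over `[0, 1]` is `1/(k + 1)`.
  have hlow : 1 / (k + 1 : ℝ) ≤ q 1 := by
    have hd : ∀ x, HasDerivAt (fun x => q x + (1 - x) ^ (k + 1) / (k + 1))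
        ((1 - x ^ 2) ^ k - (1 - x) ^ k) x := fun x => by
      have h1 : HasDerivAt (fun x : ℝ => (1 - x) ^ (k + 1) / (k + 1)) (-(1 - x) ^ k) x := by
        refine ((((hasDerivAt_id x).const_sub 1).pow (k + 1)).div_const ((k : ℝ) + 1)).congr_deriv ?_
        have : (k + 1 : ℝ) ≠ 0 := by positivity
        push_cast
        rw [div_eq_iff this]
        simp only [id]
        ring
      rw [sub_eq_add_neg]
      exact (hder' x).fun_add h1
    have hm : MonotoneOn (fun x => q x + (1 - x) ^ (k + 1) / (k + 1)) (Set.Icc 0 1) := by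
      refine monotoneOn_of_deriv_nonneg (convex_Icc _ _) (by fun_prop)
        (fun x _ => (hd x).differentiableAt.differentiableWithinAt) fun x hx => ?_
      rw [interior_Icc] at hx
      rw [(hd x).deriv, sub_nonneg]
      have := hx.1
      have := hx.2
      exact pow_le_pow_left₀ (by linarith) (by nlinarith) _
    have := hm (Set.left_mem_Icc.2 zero_le_one) (Set.right_mem_Icc.2 zero_le_one) zero_le_one
    simpa [hq0] using this
  -- On `[1/2, 1]` the derivative is at most `(3/4)^k` and the interval has length at most `1/2`.
  have hup : ∀ x : ℝ, 1 / 2 ≤ x → x ≤ 1 → q 1 - q x ≤ (3 / 4) ^ k / 2 := by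
    intro x h0 h1
    have hd : ∀ x, HasDerivAt (fun x => q x - (3 / 4) ^ k * x)
        ((1 - x ^ 2) ^ k - (3 / 4) ^ k) x := fun x => by
      simpa using (hder' x).fun_sub ((hasDerivAt_id x).const_mul ((3 / 4 : ℝ) ^ k))
    have hm : AntitoneOn (fun x => q x - (3 / 4) ^ k * x) (Set.Icc (1 / 2) 1) := by
      refine antitoneOn_of_deriv_nonpos (convex_Icc _ _) (by fun_prop)
        (fun x _ => (hd x).differentiableAt.differentiableWithinAt) fun x hx => ?_
      rw [interior_Icc] at hx
      rw [(hd x).deriv, sub_nonpos]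
      have := hx.1
      have := hx.2
      exact pow_le_pow_left₀ (by nlinarith) (by nlinarith) _
    have := hm ⟨h0, h1⟩ (Set.right_mem_Icc.2 (by norm_num)) h1
    simp only at this
    have hp : (0 : ℝ) < (3 / 4) ^ k := by positivity
    nlinarith
  have hq1pos : 0 < q 1 := lt_of_lt_of_le (by positivity) hlow
  have hev : ∀ x : ℝ, x * (C (q 1)⁻¹ * G).eval (x ^ 2) = q x / q 1 := fun x => by
    simp only [eval_mul, eval_C, hq]; ring
  refine ⟨C (q 1)⁻¹ * G, ?_, fun x h0 h1 => ?_, fun x h0 h1 => ?_⟩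
  · refine (natDegree_C_mul_le _ _).trans (hG.trans (natDegree_pow_le.trans ?_))
    have : (1 - X : ℝ[X]).natDegree ≤ 1 := by compute_degree
    nlinarith
  · rw [hev]
    refine ⟨div_nonneg ?_ hq1pos.le, ?_⟩
    · rw [← hq0]; exact hmono ⟨le_rfl, zero_le_one⟩ ⟨h0, h1⟩ h0
    · rw [div_le_one hq1pos]; exact hmono ⟨h0, h1⟩ ⟨zero_le_one, le_rfl⟩ h1
  · rw [hev, le_div_iff₀ hq1pos]
    have h2 := hup x h0 h1
    have h3 : 1 ≤ (k + 1) * q 1 := by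
      rw [div_le_iff₀ (by positivity)] at hlow; linarith
    have hp : (0 : ℝ) < (3 / 4) ^ k := by positivity
    nlinarith

open Polynomial in
/-- Polynomial approximation `x G(x²)` of the sign function, of degree `O(log(1/ε)/δ)`. -/
theorem exists_sign_poly (δ ε : ℝ) (hδ : 0 < δ) (hδ1 : δ ≤ 1) (hε : 0 < ε) (hε2 : ε < 1 / 2) :
    ∃ (e : ℕ) (G : ℝ[X]), G.natDegree ≤ e ∧
      ((2 * e + 3 : ℕ) : ℝ) ≤ 1100 * (Real.log (1 / ε) / δ) ∧
      (∀ x : ℝ, 0 ≤ x → x ≤ 1 → 0 ≤ x * G.eval (x ^ 2) ∧ x * G.eval (x ^ 2) ≤ 1) ∧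
      ∀ x : ℝ, δ ≤ x → x ≤ 1 → 1 - ε ^ 2 / 2 ≤ x * G.eval (x ^ 2) := by
  set L := Real.log (1 / ε) with hL
  have hL1 : 0.69 ≤ L := by
    have h1 : Real.log 2 ≤ L := Real.log_le_log (by norm_num) (by
      rw [le_div_iff₀ hε]; linarith)
    have := Real.log_two_gt_d9
    linarith
  set r := ⌈5 / (2 * δ)⌉₊ with hr
  -- The factor `32` matches `log(32/27) ≥ 5/32`: it gives `(32/27)^k ≥ ε⁻⁵ ≥ 8/ε²`. The base
  -- `32/27` is what remains of `4/3` after Bernoulli bounds `k + 1` by `8 (9/8)^k`.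
  set k := ⌈32 * L⌉₊ with hk
  have hr1 : 5 / (2 * δ) ≤ r := Nat.le_ceil _
  have hr2 : (r : ℝ) ≤ 5 / (2 * δ) + 1 := (Nat.ceil_lt_add_one (by positivity)).le
  have hk1 : 32 * L ≤ k := Nat.le_ceil _
  have hk2 : (k : ℝ) ≤ 32 * L + 1 := (Nat.ceil_lt_add_one (by positivity)).le
  obtain ⟨G₁, hd₁, hb₁, hs₁⟩ := exists_coarse_sign_poly r δ hδ hδ1 (by
    rw [div_le_iff₀ (by positivity)] at hr1; nlinarith)
  obtain ⟨G₂, hd₂, hb₂, hs₂⟩ := exists_amplifying_poly k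
  have hev : ∀ x : ℝ, x * (G₁ * G₂.comp (X * G₁ ^ 2)).eval (x ^ 2) =
      (x * G₁.eval (x ^ 2)) * G₂.eval ((x * G₁.eval (x ^ 2)) ^ 2) := fun x => by
    simp only [eval_mul, eval_comp, eval_pow, eval_X, mul_pow]; ring
  have herr : ((k : ℝ) + 1) * (3 / 4) ^ k / 2 ≤ ε ^ 2 / 2 := by
    have h1 : ((k : ℝ) + 1) ≤ 8 * (9 / 8) ^ k := by
      have := one_add_mul_le_pow (a := (1 / 8 : ℝ)) (by norm_num) k
      norm_num at this ⊢
      linarith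
    have h2 : 8 / ε ^ 2 ≤ (32 / 27 : ℝ) ^ k := by
      have hlog : (5 / 32 : ℝ) ≤ Real.log (32 / 27) := by
        have := Real.one_sub_inv_le_log_of_pos (x := 32 / 27) (by norm_num)
        norm_num at this ⊢
        linarith
      have h3 : Real.exp (5 * L) ≤ (32 / 27 : ℝ) ^ k := by
        rw [← Real.exp_log (show (0 : ℝ) < 32 / 27 by norm_num), ← Real.exp_nat_mul]
        refine Real.exp_le_exp.2 ?_
        have : (0 : ℝ) ≤ k := by positivity
        nlinarith
      refine le_trans ?_ h3
      have h4 : Real.exp (5 * L) = (1 / ε) ^ 5 := by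
        rw [show (5 : ℝ) * L = ((5 : ℕ) : ℝ) * L by norm_num, Real.exp_nat_mul, hL,
          Real.exp_log (by positivity)]
      rw [h4, div_pow, one_pow, div_le_div_iff₀ (by positivity) (by positivity)]
      have h5 : ε ^ 3 ≤ (1 / 2) ^ 3 := by gcongr
      have h6 : 0 < ε ^ 2 := by positivity
      nlinarith
    have h7 : ((k : ℝ) + 1) * (3 / 4) ^ k ≤ 8 * (27 / 32) ^ k := by
      calc ((k : ℝ) + 1) * (3 / 4) ^ k ≤ 8 * (9 / 8) ^ k * (3 / 4) ^ k := by gcongr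
        _ = 8 * (27 / 32) ^ k := by rw [mul_assoc, ← mul_pow]; norm_num
    have h8 : (27 / 32 : ℝ) ^ k ≤ ε ^ 2 / 8 := by
      have := inv_anti₀ (by positivity) h2
      rw [← inv_pow, inv_div] at this
      norm_num at this ⊢
      linarith
    linarith
  -- This `e` satisfies `2e + 1 = (4r + 1)(2k + 1)`, the product of the degree bounds of the two odd
  -- polynomials.
  refine ⟨2 * r + k * (4 * r + 1), G₁ * G₂.comp (X * G₁ ^ 2), ?_, ?_, ?_, ?_⟩
  · refine natDegree_mul_le.trans (add_le_add hd₁ ?_)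
    rw [natDegree_comp]
    refine Nat.mul_le_mul hd₂ (natDegree_mul_le.trans ?_)
    have := natDegree_pow_le (p := G₁) (n := 2)
    have : (X : ℝ[X]).natDegree ≤ 1 := natDegree_X_le
    omega
  · have h1 : (4 * r + 1 : ℝ) ≤ 15 / δ := by
      have : 1 ≤ 1 / δ := by rw [le_div_iff₀ hδ]; linarith
      have e1 : 5 / (2 * δ) = 5 / 2 * (1 / δ) := by field_simp
      have e2 : 15 / δ = 15 * (1 / δ) := by ring
      rw [e2]; linarith
    have h2 : (2 * k + 1 : ℝ) ≤ 69 * L := by linarith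
    have h3 : (2 : ℝ) ≤ 3 * L / δ := by
      rw [le_div_iff₀ hδ]; nlinarith
    have h4 : (4 * r + 1 : ℝ) * (2 * k + 1) ≤ 15 / δ * (69 * L) := by gcongr
    have h5 : 0 ≤ L / δ := by positivity
    have e1 : 15 / δ * (69 * L) = 1035 * (L / δ) := by ring
    have e2 : 3 * L / δ = 3 * (L / δ) := by ring
    push_cast
    nlinarith
  · intro x h0 h1
    rw [hev]
    obtain ⟨a, b⟩ := hb₁ x h0 h1
    exact hb₂ _ a b
  · intro x h0 h1
    rw [hev]
    refine le_trans (by linarith) (hs₂ _ (hs₁ x h0 h1) (hb₁ x (hδ.le.trans h0) h1).2)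

/-! ### Fejér–Riesz factorisation of non-negative cosine polynomials -/

theorem nonneg_on_Icc_of_nonneg_on_Ioo {f : ℝ → ℝ} (hf : Continuous f) {a b : ℝ} (hab : a < b)
    (h : ∀ x ∈ Set.Ioo a b, 0 ≤ f x) : ∀ x ∈ Set.Icc a b, 0 ≤ f x := by
  intro x hx
  rw [← closure_Ioo hab.ne] at hx
  exact closure_minimal (t := {x | 0 ≤ f x}) h (isClosed_le continuous_const hf) hx

theorem normSq_exp_mul_I (θ : ℝ) : Complex.normSq (Complex.exp (θ * Complex.I)) = 1 := by
  rw [Complex.normSq_eq_norm_sq, Complex.norm_exp_ofReal_mul_I, one_pow]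

-- Since `|b - c e^{iθ}|² = b² + c² - 2bc cos θ`, the task is to solve `b² + c² = a`, `2bc = 1`; the
-- square roots of `(a ± 1)/2` are `(b ± c)/√2`.
open Polynomial in
theorem exists_spectral_factor_linear_pos (a : ℝ) (ha : 1 ≤ a) :
    ∃ h : ℝ[X], h.natDegree ≤ 1 ∧ ∀ θ : ℝ,
      Complex.normSq (aeval (Complex.exp (θ * Complex.I)) h) = a - Real.cos θ := by
  set α := √((a + 1) / 2) with hα
  set β := √((a - 1) / 2) with hβ
  have h1 : α ^ 2 = (a + 1) / 2 := Real.sq_sqrt (by linarith)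
  have h2 : β ^ 2 = (a - 1) / 2 := Real.sq_sqrt (by linarith)
  refine ⟨C ((α + β) / √2) - C ((α - β) / √2) * X, by compute_degree, fun θ => ?_⟩
  have hs : √2 ^ 2 = (2 : ℝ) := Real.sq_sqrt (by norm_num)
  have hcs := Real.sin_sq_add_cos_sq θ
  simp only [map_sub, map_mul, aeval_C, aeval_X, Complex.normSq_apply, Complex.sub_re,
    Complex.sub_im, Complex.mul_re, Complex.mul_im, Complex.exp_ofReal_mul_I_re,
    Complex.exp_ofReal_mul_I_im, Complex.coe_algebraMap, Complex.ofReal_re, Complex.ofReal_im]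
  field_simp
  rw [hs]
  linear_combination (α - β) ^ 2 * hcs + (2 - 2 * Real.cos θ) * h1 + (2 + 2 * Real.cos θ) * h2

-- For coefficients `α, β, γ`, matching powers of `cos θ` requires `4αγ = 1`, `β(α + γ) = -u` and
-- `(α + γ)² + β² = B`. Hence `T = (α + γ)²` solves `T² - BT + u² = 0`. The larger root is at least
-- `1`, which makes `(α - γ)² = T - 1` solvable over the reals.
open Polynomial in
theorem exists_spectral_factor_quadratic (u v : ℝ) :
    ∃ h : ℝ[X], h.natDegree ≤ 2 ∧ ∀ θ : ℝ,
      Complex.normSq (aeval (Complex.exp (θ * Complex.I)) h) = (Real.cos θ - u) ^ 2 + v ^ 2 := by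
  set B := u ^ 2 + v ^ 2 + 1 with hB
  have hdisc : 0 ≤ B ^ 2 - 4 * u ^ 2 := by
    have : B ^ 2 - 4 * u ^ 2 = (u ^ 2 + v ^ 2 - 1) ^ 2 + 4 * v ^ 2 := by rw [hB]; ring
    rw [this]; positivity
  set D := √(B ^ 2 - 4 * u ^ 2) with hD
  have hD2 : D ^ 2 = B ^ 2 - 4 * u ^ 2 := Real.sq_sqrt hdisc
  have hD0 : 0 ≤ D := Real.sqrt_nonneg _
  set T := (B + D) / 2 with hT
  have hTq : T ^ 2 - B * T + u ^ 2 = 0 := by rw [hT]; linear_combination hD2 / 4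
  have hT1 : 1 ≤ T := by
    have h1 : (1 - u ^ 2 - v ^ 2) ≤ D := by
      refine Real.le_sqrt_of_sq_le ?_
      rw [hB]; nlinarith [sq_nonneg v]
    rw [hT, hB]; linarith
  have hT0 : 0 < T := by linarith
  set s := √T with hs
  have hs2 : s ^ 2 = T := Real.sq_sqrt hT0.le
  have hs0 : 0 < s := Real.sqrt_pos.2 hT0
  set t := √(T - 1) with ht
  have ht2 : t ^ 2 = T - 1 := Real.sq_sqrt (by linarith)
  refine ⟨C ((s + t) / 2) + C (-u / s) * X + C ((s - t) / 2) * X ^ 2, by compute_degree,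
    fun θ => ?_⟩
  have hcs := Real.sin_sq_add_cos_sq θ
  have hsq : (-u / s) ^ 2 = B - T := by
    rw [div_pow, hs2, div_eq_iff hT0.ne']; linear_combination hTq
  have hsb : s * (-u / s) = -u := by field_simp
  set b := -u / s with hb
  simp only [map_add, map_mul, aeval_C, aeval_X, Complex.normSq_apply, Complex.add_re,
    Complex.add_im, Complex.mul_re, Complex.mul_im, Complex.exp_ofReal_mul_I_re, pow_two,
    Complex.exp_ofReal_mul_I_im, Complex.coe_algebraMap, Complex.ofReal_re, Complex.ofReal_im]
  set c := Real.cos θ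
  set w := Real.sin θ
  have hw : w ^ 2 = 1 - c ^ 2 := by linear_combination hcs
  have e : ∀ α β γ : ℝ, (α + (β * c - 0 * w) + (γ * (c * c - w * w) - 0 * (c * w + w * c))) *
      (α + (β * c - 0 * w) + (γ * (c * c - w * w) - 0 * (c * w + w * c))) +
      (0 + (β * w + 0 * c) + (γ * (c * w + w * c) + 0 * (c * c - w * w))) *
      (0 + (β * w + 0 * c) + (γ * (c * w + w * c) + 0 * (c * c - w * w))) =
      (α + γ) ^ 2 + β ^ 2 - 4 * (α * γ) + 2 * (β * (α + γ)) * c + 4 * (α * γ) * c ^ 2 := by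
    intro α β γ
    have hw4 : w ^ 4 = (1 - c ^ 2) ^ 2 := by rw [← hw]; ring
    ring_nf
    rw [hw4, hw]
    ring
  rw [e]
  have e1 : (s + t) / 2 + (s - t) / 2 = s := by ring
  have e2 : 4 * ((s + t) / 2 * ((s - t) / 2)) = 1 := by linear_combination hs2 - ht2
  rw [e1, e2, mul_comm b s, hsb, hsq, hs2, hB]
  ring

open Polynomial in
/-- The Fejér–Riesz theorem for cosine polynomials with real coefficients. -/
theorem exists_spectral_factor (n : ℕ) : ∀ R : ℝ[X], R.natDegree ≤ n →
    (∀ x ∈ Set.Icc (-1 : ℝ) 1, 0 ≤ R.eval x) →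
    ∃ h : ℝ[X], h.natDegree ≤ n ∧ ∀ θ : ℝ,
      Complex.normSq (aeval (Complex.exp (θ * Complex.I)) h) = R.eval (Real.cos θ) := by
  induction n using Nat.strong_induction_on with
  | _ n ih =>
  intro R hdeg hR
  have hcos : ∀ θ, Real.cos θ ∈ Set.Icc (-1 : ℝ) 1 := fun θ =>
    ⟨Real.neg_one_le_cos θ, Real.cos_le_one θ⟩
  by_cases h0 : R.natDegree = 0
  · rw [natDegree_eq_zero] at h0
    obtain ⟨c, rfl⟩ := h0
    have hc : 0 ≤ c := by simpa using hR 0 (by norm_num)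
    refine ⟨C √c, by simp, fun θ => ?_⟩
    simp [Complex.normSq_ofReal, Real.mul_self_sqrt hc]
  have hR0 : R ≠ 0 := by rintro rfl; simp at h0
  -- a nonnegative cofactor of a factor with a spectral factor reduces the degree
  have step : ∀ (F S : ℝ[X]) (k : ℕ), 0 < k → R = F * S → F.natDegree = k →
      (∀ x ∈ Set.Icc (-1 : ℝ) 1, 0 ≤ S.eval x) →
      (∃ f : ℝ[X], f.natDegree ≤ k ∧ ∀ θ : ℝ,
        Complex.normSq (aeval (Complex.exp (θ * Complex.I)) f) = F.eval (Real.cos θ)) →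
      ∃ h : ℝ[X], h.natDegree ≤ n ∧ ∀ θ : ℝ,
        Complex.normSq (aeval (Complex.exp (θ * Complex.I)) h) = R.eval (Real.cos θ) := by
    rintro F S k hk rfl hF hS ⟨f, hf, hfe⟩
    have hdF : (F * S).natDegree = k + S.natDegree := by
      rw [natDegree_mul (left_ne_zero_of_mul hR0) (right_ne_zero_of_mul hR0), hF]
    obtain ⟨g, hg, hge⟩ := ih (n - k) (by omega) S (by omega) hS
    refine ⟨f * g, natDegree_mul_le.trans (by omega), fun θ => ?_⟩
    rw [map_mul, map_mul, hfe, hge, eval_mul]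
  obtain ⟨z, hz⟩ := IsAlgClosed.exists_aeval_eq_zero ℂ R (by
    exact fun h => h0 (natDegree_eq_zero_iff_degree_le_zero.2 h.le))
  by_cases him : z.im = 0
  · have hroot : R.eval z.re = 0 := by
      have : z = (z.re : ℂ) := Complex.ext rfl (by simpa using him)
      rw [this] at hz
      have h2 := aeval_algebraMap_apply ℂ z.re R
      rw [Complex.coe_algebraMap, hz] at h2
      have h3 := Complex.ofReal_eq_zero.1 h2.symm
      simpa using h3
    set a := z.re
    obtain ⟨S, hS⟩ := dvd_iff_isRoot.2 hroot
    have hSe : ∀ x, R.eval x = (x - a) * S.eval x := fun x => by rw [hS]; simp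
    -- A real root outside `(-1, 1)` gives a linear factor of constant sign on the interval. A root
    -- inside must be at least double, since the quotient changes sign there otherwise.
    rcases le_or_gt 1 a with ha | ha
    · refine step (C a - X) (-S) 1 one_pos (by rw [hS]; ring) (by compute_degree!) ?_ ?_
      · refine nonneg_on_Icc_of_nonneg_on_Ioo (by fun_prop) (by norm_num) fun x hx => ?_
        have := hR x ⟨hx.1.le, hx.2.le⟩
        rw [hSe] at this
        have hx2 := hx.2
        rw [eval_neg]
        nlinarith
      · obtain ⟨f, hf, hfe⟩ := exists_spectral_factor_linear_pos a ha
        exact ⟨f, hf, fun θ => by simp [hfe]⟩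
    rcases le_or_gt a (-1) with ha' | ha'
    · refine step (X - C a) S 1 one_pos hS (by compute_degree!) ?_ ?_
      · refine nonneg_on_Icc_of_nonneg_on_Ioo (by fun_prop) (by norm_num) fun x hx => ?_
        have := hR x ⟨hx.1.le, hx.2.le⟩
        rw [hSe] at this
        have hx2 := hx.1
        exact nonneg_of_mul_nonneg_right this (by linarith)
      · obtain ⟨f, hf, hfe⟩ := exists_spectral_factor_linear_pos (-a) (by linarith)
        -- Shifting `θ` by `π` turns `-a - cos θ` into `cos θ - a` and `e^{iθ}` into `-e^{iθ}`.
        refine ⟨f.comp (-X), ?_, fun θ => ?_⟩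
        · rw [natDegree_comp]; simpa using hf
        · have := hfe (θ + Real.pi)
          rw [Real.cos_add_pi] at this
          push_cast at this
          rw [add_mul, Complex.exp_add, Complex.exp_pi_mul_I] at this
          rw [aeval_comp]
          simp only [map_neg, aeval_X]
          rw [mul_neg_one] at this
          rw [this]
          simp; ring
    · have hS1 : ∀ x ∈ Set.Icc a 1, 0 ≤ S.eval x :=
        nonneg_on_Icc_of_nonneg_on_Ioo (by fun_prop) ha fun x hx => by
          have := hR x ⟨by linarith [hx.1], hx.2.le⟩
          rw [hSe] at this
          exact nonneg_of_mul_nonneg_right this (by linarith [hx.1])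
      have hS2 : ∀ x ∈ Set.Icc (-1) a, 0 ≤ (-S).eval x :=
        nonneg_on_Icc_of_nonneg_on_Ioo (by fun_prop) ha' fun x hx => by
          have := hR x ⟨hx.1.le, by linarith [hx.2]⟩
          rw [hSe] at this
          have hx2 := hx.2
          rw [eval_neg]
          nlinarith
      have hSa : S.eval a = 0 := by
        have h1 := hS1 a ⟨le_rfl, ha.le⟩
        have h2 := hS2 a ⟨ha'.le, le_rfl⟩
        rw [eval_neg] at h2
        linarith
      obtain ⟨S', hS'⟩ := dvd_iff_isRoot.2 hSa
      refine step ((X - C a) ^ 2) S' 2 two_pos (by rw [hS, hS']; ring) (by compute_degree!) ?_ ?_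
      · intro x hx
        have key1 : ∀ x ∈ Set.Icc a 1, 0 ≤ S'.eval x :=
          nonneg_on_Icc_of_nonneg_on_Ioo (by fun_prop) ha fun x hx => by
            have := hS1 x ⟨hx.1.le, hx.2.le⟩
            rw [hS'] at this
            simp only [eval_mul, eval_sub, eval_X, eval_C] at this
            exact nonneg_of_mul_nonneg_right this (by linarith [hx.1])
        have key2 : ∀ x ∈ Set.Icc (-1) a, 0 ≤ S'.eval x :=
          nonneg_on_Icc_of_nonneg_on_Ioo (by fun_prop) ha' fun x hx => by
            have := hS2 x ⟨hx.1.le, hx.2.le⟩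
            rw [hS'] at this
            simp only [eval_neg, eval_mul, eval_sub, eval_X, eval_C] at this
            have := hx.2
            nlinarith
        rcases le_total a x with h | h
        · exact key1 x ⟨h, hx.2⟩
        · exact key2 x ⟨hx.1, h⟩
      · obtain ⟨f, hf, hfe⟩ := exists_spectral_factor_quadratic a 0
        exact ⟨f, hf, fun θ => by simp [hfe]⟩
  · obtain ⟨S, hS⟩ := quadratic_dvd_of_aeval_eq_zero_im_ne_zero R hz him
    have hnorm : ‖z‖ ^ 2 = z.re ^ 2 + z.im ^ 2 := by
      rw [← Complex.normSq_eq_norm_sq, Complex.normSq_apply]; ring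
    have hFe : ∀ x : ℝ, (X ^ 2 - C (2 * z.re) * X + C (‖z‖ ^ 2)).eval x =
        (x - z.re) ^ 2 + z.im ^ 2 := fun x => by
      rw [hnorm]; simp; ring
    refine step _ S 2 two_pos hS (by compute_degree!) ?_ ?_
    · intro x hx
      have := hR x hx
      rw [hS, eval_mul, hFe] at this
      have hpos : 0 < (x - z.re) ^ 2 + z.im ^ 2 := by positivity
      exact nonneg_of_mul_nonneg_right this hpos
    · obtain ⟨f, hf, hfe⟩ := exists_spectral_factor_quadratic z.re z.im
      exact ⟨f, hf, fun θ => by rw [hFe, hfe]⟩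

/-! ### Quantum signal processing: phases from a normalised pair of polynomials -/

open Polynomial in
/-- On the unit circle, `|p|² + |h|² = 1` forces the leading and constant coefficients to be
orthogonal. -/
theorem coeff_mul_coeff_zero_add_eq_zero {d : ℕ} (hd : 0 < d) {p h : ℝ[X]}
    (hp : p.natDegree ≤ d) (hh : h.natDegree ≤ d)
    (hc : ∀ θ : ℝ, Complex.normSq (aeval (Complex.exp (θ * Complex.I)) p) +
      Complex.normSq (aeval (Complex.exp (θ * Complex.I)) h) = 1) :
    p.coeff 0 * p.coeff d + h.coeff 0 * h.coeff d = 0 := by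
  -- On the unit circle the reflected polynomial equals `w^d` times the conjugate of `q(w)`, because
  -- `q` has real coefficients.
  have hrefl : ∀ (q : ℝ[X]), q.natDegree ≤ d → ∀ θ : ℝ,
      aeval (Complex.exp (θ * Complex.I)) (q * reflect d q) =
        Complex.exp (θ * Complex.I) ^ d *
          (Complex.normSq (aeval (Complex.exp (θ * Complex.I)) q) : ℂ) := by
    intro q hq θ
    set w := Complex.exp (θ * Complex.I) with hw
    have hw0 : w ≠ 0 := Complex.exp_ne_zero _
    have hconj : (starRingEnd ℂ) w = w⁻¹ := by
      rw [Complex.inv_def, Complex.normSq_eq_norm_sq, Complex.norm_exp_ofReal_mul_I]; simp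
    let i : Invertible (w⁻¹) := ⟨w, mul_inv_cancel₀ hw0, inv_mul_cancel₀ hw0⟩
    have h1 := eval₂_reflect_mul_pow (algebraMap ℝ ℂ) (w⁻¹) d q hq
    have h2 : ⅟(w⁻¹) = w := rfl
    rw [h2, ← aeval_def, ← aeval_def, ← hconj, ← Complex.conjAe_coe] at h1
    have h3 : aeval (Complex.conjAe w) q = Complex.conjAe (aeval w q) :=
      aeval_algHom_apply (Complex.conjAe : ℂ →ₐ[ℝ] ℂ) w q
    rw [h3, Complex.conjAe_coe, hconj, inv_pow] at h1
    have h4 : aeval w (reflect d q) = w ^ d * (starRingEnd ℂ) (aeval w q) := by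
      rw [← h1]; field_simp
    rw [map_mul, h4, Complex.normSq_eq_conj_mul_self]
    ring
  -- The identity holds at infinitely many points of the circle, hence as polynomials; its
  -- coefficient of degree `2d > d` is the claim.
  have hzero : (p * reflect d p + h * reflect d h - X ^ d).map (algebraMap ℝ ℂ) = 0 := by
    refine eq_zero_of_infinite_isRoot _ ?_
    have hinj : Set.InjOn (fun θ : ℝ => Complex.exp (θ * Complex.I)) (Set.Ioo (-Real.pi) Real.pi) := by
      intro a ha b hb hab
      have := Complex.exp_inj_of_neg_pi_lt_of_le_pi (x := a * Complex.I) (y := b * Complex.I)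
        (by simpa using ha.1) (by simpa using ha.2.le) (by simpa using hb.1)
        (by simpa using hb.2.le) hab
      simpa using this
    have hinf := (Set.Ioo_infinite (show -Real.pi < Real.pi by linarith [Real.pi_pos])).image hinj
    refine hinf.mono ?_
    rintro _ ⟨θ, -, rfl⟩
    simp only [Set.mem_ofPred_eq, IsRoot.def, eval_map_algebraMap]
    rw [map_sub, map_add, hrefl p hp, hrefl h hh, ← mul_add, ← Complex.ofReal_add, hc]
    simp
  have hzero' : p * reflect d p + h * reflect d h - X ^ d = 0 :=
    (Polynomial.map_eq_zero_iff (algebraMap ℝ ℂ).injective).1 hzero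
  have hco : ∀ q : ℝ[X], q.natDegree ≤ d → (q * reflect d q).coeff (d + d) = q.coeff 0 * q.coeff d := by
    intro q hq
    rw [coeff_mul_add_eq_of_natDegree_le hq (natDegree_reflect_le.trans (max_le le_rfl hq)),
      coeff_reflect, revAt_le le_rfl, Nat.sub_self, mul_comm]
  have := congrArg (fun q => coeff q (d + d)) hzero'
  simp only [coeff_sub, coeff_add, hco p hp, hco h hh, coeff_X_pow, coeff_zero] at this
  rw [if_neg (by omega)] at this
  linarith

/-- The vector `(cos φ, sin φ)` has to be orthogonal to `(a, b)` and parallel to `(a', b')`; these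
demands agree because the two vectors are orthogonal. -/
theorem exists_rotation_of_orthogonal (a b a' b' : ℝ) (h : a * a' + b * b' = 0) :
    ∃ φ : ℝ, Real.cos φ * a + Real.sin φ * b = 0 ∧ Real.cos φ * b' - Real.sin φ * a' = 0 := by
  by_cases h0 : (⟨a', b'⟩ : ℂ) = 0
  · have h1 : a' = 0 := congrArg Complex.re h0
    have h2 : b' = 0 := congrArg Complex.im h0
    refine ⟨Complex.arg ⟨a, b⟩ + Real.pi / 2, ?_, by simp [h1, h2]⟩
    have h3 := Complex.norm_mul_cos_arg ⟨a, b⟩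
    have h4 := Complex.norm_mul_sin_arg ⟨a, b⟩
    simp only at h3 h4
    rw [Real.cos_add_pi_div_two, Real.sin_add_pi_div_two]
    set r := ‖(⟨a, b⟩ : ℂ)‖
    set c := Real.cos (Complex.arg ⟨a, b⟩)
    set s := Real.sin (Complex.arg ⟨a, b⟩)
    rw [← h3, ← h4]; ring
  · refine ⟨Complex.arg ⟨a', b'⟩, ?_, ?_⟩
    all_goals
      have h3 := Complex.norm_mul_cos_arg ⟨a', b'⟩
      have h4 := Complex.norm_mul_sin_arg ⟨a', b'⟩
      have hr : ‖(⟨a', b'⟩ : ℂ)‖ ≠ 0 := norm_ne_zero_iff.2 h0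
      simp only at h3 h4
      set r := ‖(⟨a', b'⟩ : ℂ)‖
      set c := Real.cos (Complex.arg ⟨a', b'⟩)
      set s := Real.sin (Complex.arg ⟨a', b'⟩)
      refine mul_left_cancel₀ hr ?_
    · rw [← h3, ← h4] at h
      linear_combination h
    · rw [← h3, ← h4]; ring

/-- The coordinates of `U_Φ v` in the invariant subspace of a singular value `x`, where the
(unnormalised) basis vectors are the singular vector and its image outside the projector. -/
noncomputable def qsvAmp (x : ℝ) : List ℝ → ℂ × ℂ
  | [] => (1, 0)
  | φ :: l =>
    (Complex.exp (φ * Complex.I) * (x * (qsvAmp x l).1 + (1 - x ^ 2) * (qsvAmp x l).2),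
      Complex.exp (-(φ * Complex.I)) * ((qsvAmp x l).1 - x * (qsvAmp x l).2))

/-- The empty sequence offers no free phase. Two extra factors, the second with phase `0`, act as a
pure phase `e^{iμ}`; this is the base case of the construction and costs two uses of the unitary. -/
theorem qsvAmp_phase_zero (x μ : ℝ) : qsvAmp x [μ, 0] = (Complex.exp (μ * Complex.I), 0) := by
  simp [qsvAmp, ← sq]

/-- A shift of the innermost phase is a global phase, so it can absorb the outermost one. -/
theorem qsvAmp_append (x μ ν : ℝ) (l : List ℝ) :
    qsvAmp x (l ++ [μ + ν, 0]) = (Complex.exp (ν * Complex.I) * (qsvAmp x (l ++ [μ, 0])).1,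
      Complex.exp (ν * Complex.I) * (qsvAmp x (l ++ [μ, 0])).2) := by
  induction l with
  | nil =>
    simp only [List.nil_append, qsvAmp_phase_zero]
    push_cast
    rw [add_mul, Complex.exp_add]
    simp [mul_comm]
  | cons φ l ih =>
    simp only [List.cons_append, qsvAmp, ih, Prod.mk.injEq]
    constructor <;> ring

theorem exp_pi_div_four_eq :
    Complex.exp ((Real.pi / 4 : ℝ) * Complex.I) =
      Complex.I * Complex.exp (-((Real.pi / 4 : ℝ) * Complex.I)) := by
  have h : Complex.exp ((Real.pi / 2 : ℝ) * Complex.I) = Complex.I := by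
    push_cast; rw [Complex.exp_pi_div_two_mul_I]
  refine Eq.trans ?_ (congrArg (· * Complex.exp (-((Real.pi / 4 : ℝ) * Complex.I))) h)
  rw [← Complex.exp_add]
  congr 1
  push_cast
  ring

open Polynomial in
/-- Quantum signal processing: a pair of real polynomials that is normalised on the unit circle is
realised by a sequence of phases. -/
theorem exists_phases_of_normSq_add_eq_one (d : ℕ) : ∀ p h : ℝ[X], p.natDegree ≤ d →
    h.natDegree ≤ d →
    (∀ θ : ℝ, Complex.normSq (aeval (Complex.exp (θ * Complex.I)) p) +
      Complex.normSq (aeval (Complex.exp (θ * Complex.I)) h) = 1) →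
    ∃ (μ : ℝ) (l : List ℝ), l.length = d ∧ ∀ (θ : ℝ) (z P T : ℂ),
      z = Complex.exp (θ * Complex.I) →
      P = Complex.I ^ d * Complex.exp ((Real.pi / 4 : ℝ) * Complex.I) *
        (qsvAmp (Real.cos θ) (l ++ [μ, 0])).1 →
      T = Complex.I ^ d * Complex.exp (-((Real.pi / 4 : ℝ) * Complex.I)) *
        (qsvAmp (Real.cos θ) (l ++ [μ, 0])).2 →
      aeval (z ^ 2) p = z ^ d * (P.re + Complex.I * (Real.sin θ * T.im)) ∧
      aeval (z ^ 2) h = z ^ d * (P.im + Complex.I * (Real.sin θ * T.re)) := by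
  -- The factors `I ^ d` and `e^{±iπ/4}` turn the reflection in the recursion of `qsvAmp` into a
  -- rotation. The real pair `p`, `h` then encodes the real and imaginary parts of `P` and `T`,
  -- separated by parity in `θ`.
  induction d with
  | zero =>
    intro p h hp hh hc
    obtain ⟨a, rfl⟩ := natDegree_eq_zero.1 (Nat.le_zero.1 hp)
    obtain ⟨b, rfl⟩ := natDegree_eq_zero.1 (Nat.le_zero.1 hh)
    have hab : a ^ 2 + b ^ 2 = 1 := by
      have := hc 0
      simp only [aeval_C, Complex.coe_algebraMap, Complex.normSq_ofReal] at this
      linarith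
    have hn : ‖(⟨a, b⟩ : ℂ)‖ = 1 := by
      rw [← sq_eq_sq₀ (norm_nonneg _) zero_le_one, ← Complex.normSq_eq_norm_sq,
        Complex.normSq_mk]
      linarith
    refine ⟨Complex.arg ⟨a, b⟩ - Real.pi / 4, [], rfl, ?_⟩
    rintro θ z P T - hP hT
    rw [List.nil_append, qsvAmp_phase_zero] at hP hT
    have hP' : P = ⟨a, b⟩ := by
      have := Complex.norm_mul_exp_arg_mul_I ⟨a, b⟩
      rw [hn] at this
      refine Eq.trans ?_ this
      rw [hP, pow_zero, one_mul, ← Complex.exp_add]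
      rw [Complex.ofReal_one, one_mul, Complex.ofReal_sub, ← add_mul, add_sub_cancel]
    have hT' : T = 0 := by rw [hT]; simp
    simp [hP', hT']
  | succ d ih =>
    intro p h hp hh hc
    -- This rotation of the pair makes one component divisible by `X` and removes the top
    -- coefficient of the other, so both lose a degree after division by `X`.
    obtain ⟨φ, h1, h2⟩ := exists_rotation_of_orthogonal _ _ _ _
      (coeff_mul_coeff_zero_add_eq_zero d.succ_pos hp hh hc)
    set c := Real.cos φ with hcφ
    set s := Real.sin φ with hsφ
    have hcs : s ^ 2 + c ^ 2 = 1 := Real.sin_sq_add_cos_sq φ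
    obtain ⟨p', hp'⟩ : X ∣ C c * p + C s * h := by
      rw [X_dvd_iff]; simpa using h1
    set h' := C c * h - C s * p with hh'
    have hpe : p = C c * (X * p') - C s * h' := by
      have : C s ^ 2 + C c ^ 2 = (1 : ℝ[X]) := by
        rw [← C_pow, ← C_pow, ← C_add, hcs, C_1]
      rw [← hp', hh']; linear_combination (-p) * this
    have hhe : h = C s * (X * p') + C c * h' := by
      have : C s ^ 2 + C c ^ 2 = (1 : ℝ[X]) := by
        rw [← C_pow, ← C_pow, ← C_add, hcs, C_1]
      rw [← hp', hh']; linear_combination (-h) * this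
    have hdp : p'.natDegree ≤ d := by
      by_cases h0 : p' = 0
      · simp [h0]
      have e1 : (X * p').natDegree = p'.natDegree + 1 := natDegree_X_mul h0
      have e2 : (X * p').natDegree ≤ d + 1 := by
        rw [← hp']
        exact (natDegree_add_le _ _).trans (max_le ((natDegree_C_mul_le _ _).trans hp)
          ((natDegree_C_mul_le _ _).trans hh))
      omega
    have hdh : h'.natDegree ≤ d := by
      refine natDegree_le_iff_coeff_eq_zero.2 fun N hN => ?_
      rcases Nat.lt_or_ge (d + 1) N with hN' | hN'
      · rw [hh', coeff_sub, coeff_C_mul, coeff_C_mul, coeff_eq_zero_of_natDegree_lt (by omega),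
          coeff_eq_zero_of_natDegree_lt (by omega)]
        ring
      · obtain rfl : N = d + 1 := by omega
        rw [hh', coeff_sub, coeff_C_mul, coeff_C_mul]
        linarith
    have hc' : ∀ θ : ℝ, Complex.normSq (aeval (Complex.exp (θ * Complex.I)) p') +
        Complex.normSq (aeval (Complex.exp (θ * Complex.I)) h') = 1 := by
      intro θ
      have e := hc θ
      have en : Complex.normSq (Complex.exp (θ * Complex.I)) = 1 := by
        rw [Complex.normSq_eq_norm_sq, Complex.norm_exp_ofReal_mul_I, one_pow]
      have e1 : Complex.normSq (aeval (Complex.exp (θ * Complex.I)) p') =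
          Complex.normSq (aeval (Complex.exp (θ * Complex.I)) (X * p')) := by
        rw [map_mul, map_mul, aeval_X, en, one_mul]
      rw [e1, ← hp', hh', ← e]
      simp only [map_add, map_sub, map_mul, aeval_C, Complex.coe_algebraMap]
      generalize aeval (Complex.exp (θ * Complex.I)) p = A
      generalize aeval (Complex.exp (θ * Complex.I)) h = B
      simp only [Complex.normSq_apply, Complex.add_re, Complex.add_im, Complex.sub_re,
        Complex.sub_im, Complex.re_ofReal_mul, Complex.im_ofReal_mul]
      linear_combination (A.re ^ 2 + A.im ^ 2 + B.re ^ 2 + B.im ^ 2) * hcs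
    obtain ⟨μ, l, hl, hml⟩ := ih p' h' hdp hdh hc'
    -- The shift by `π/2` compensates the additional factor `I` in `I ^ (d + 1)`.
    refine ⟨μ, (φ - Real.pi / 2) :: l, by simp [hl], ?_⟩
    rintro θ z P' T' hz hP' hT'
    obtain ⟨e1, e2⟩ := hml θ z _ _ hz rfl rfl
    rw [List.cons_append, qsvAmp] at hP' hT'
    set α := (qsvAmp (Real.cos θ) (l ++ [μ, 0])).1
    set β := (qsvAmp (Real.cos θ) (l ++ [μ, 0])).2
    set x := Real.cos θ with hx
    set y := Real.sin θ with hy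
    have hxy : y ^ 2 + x ^ 2 = 1 := Real.sin_sq_add_cos_sq θ
    have hxyc : (1 - (x : ℂ) ^ 2) = (y : ℂ) ^ 2 := by
      rw [← Complex.ofReal_pow, ← Complex.ofReal_pow, ← Complex.ofReal_one, ← Complex.ofReal_sub,
        ← hxy]
      congr 1; ring
    have hzxy : z = x + y * Complex.I := by
      rw [hz, Complex.exp_mul_I, Complex.ofReal_cos, Complex.ofReal_sin]
    have hI : Complex.exp ((Real.pi / 2 : ℝ) * Complex.I) = Complex.I := by
      push_cast; exact Complex.exp_pi_div_two_mul_I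
    have hφ1 : Complex.exp (((φ - Real.pi / 2 : ℝ) : ℂ) * Complex.I) =
        (c + s * Complex.I) * (-Complex.I) := by
      rw [Complex.ofReal_sub, sub_mul, Complex.exp_sub, hI, Complex.exp_mul_I, hcφ, hsφ,
        Complex.ofReal_cos, Complex.ofReal_sin, Complex.div_I]
      ring
    have hφ2 : Complex.exp (-(((φ - Real.pi / 2 : ℝ) : ℂ) * Complex.I)) =
        (c - s * Complex.I) * Complex.I := by
      rw [Complex.ofReal_sub, sub_mul, neg_sub, Complex.exp_sub, hI, div_eq_mul_inv,
        ← Complex.exp_neg, ← neg_mul, Complex.exp_mul_I, hcφ, hsφ,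
        Complex.ofReal_cos, Complex.ofReal_sin, Complex.cos_neg, Complex.sin_neg]
      ring
    set P := Complex.I ^ d * Complex.exp ((Real.pi / 4 : ℝ) * Complex.I) * α with hP
    set T := Complex.I ^ d * Complex.exp (-((Real.pi / 4 : ℝ) * Complex.I)) * β with hT
    have hPP : P' = (c + s * Complex.I) * (x * P + Complex.I * (y ^ 2 * T)) := by
      rw [hP', hφ1, hxyc, hP, hT, exp_pi_div_four_eq, pow_succ]
      linear_combination (-(c + s * Complex.I) * Complex.I ^ d *
        Complex.exp (-((Real.pi / 4 : ℝ) * Complex.I)) * Complex.I * (x * α + y ^ 2 * β)) *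
        Complex.I_mul_I
    have hTT : T' = (c - s * Complex.I) * (Complex.I * P + x * T) := by
      rw [hT', hφ2, hP, hT, exp_pi_div_four_eq, pow_succ]
      linear_combination (-(c - s * Complex.I) * Complex.I ^ d *
        Complex.exp (-((Real.pi / 4 : ℝ) * Complex.I)) * (x * β)) *
        Complex.I_mul_I
    clear_value P T
    have hzz : z * (x - y * Complex.I) = 1 := by
      rw [hzxy]
      linear_combination -hxyc - (y : ℂ) ^ 2 * Complex.I_mul_I
    -- In terms of the encoded pair, one more phase multiplies the components by `z` and `z⁻¹` and
    -- then rotates by `φ`, which undoes the reduction.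
    have hF : (P'.re + Complex.I * (y * T'.im)) = c * z * (P.re + Complex.I * (y * T.im)) -
        s * (x - y * Complex.I) * (P.im + Complex.I * (y * T.re)) := by
      rw [hPP, hTT, hzxy]
      apply Complex.ext <;> simp [pow_two] <;> ring
    have hG : (P'.im + Complex.I * (y * T'.re)) = s * z * (P.re + Complex.I * (y * T.im)) +
        c * (x - y * Complex.I) * (P.im + Complex.I * (y * T.re)) := by
      rw [hPP, hTT, hzxy]
      apply Complex.ext <;> simp [pow_two] <;> ring
    constructor
    · rw [hpe]
      simp only [map_sub, map_mul, aeval_C, aeval_X, Complex.coe_algebraMap, e1, e2]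
      rw [hF]
      linear_combination (s * z ^ d * (P.im + Complex.I * (y * T.re))) * hzz
    · rw [hhe]
      simp only [map_add, map_mul, aeval_C, aeval_X, Complex.coe_algebraMap, e1, e2]
      rw [hG]
      linear_combination (-c * z ^ d * (P.im + Complex.I * (y * T.re))) * hzz

/-! ### Action of the phased sequence on singular vectors -/

theorem phaseOp_zero {H : Type*} [NormedAddCommGroup H] [InnerProductSpace ℂ H]
    (P : H →L[ℂ] H) : phaseOp P 0 = 1 := by
  simp [phaseOp]

section Eigen

variable {H : Type*} [NormedAddCommGroup H] [InnerProductSpace ℂ H] [CompleteSpace H]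

theorem exp_apply_of_apply_eq_smul (A : H →L[ℂ] H) (c : ℂ) (v : H) (h : A v = c • v) :
    NormedSpace.exp A v = Complex.exp c • v := by
  have hpow : ∀ n : ℕ, (A ^ n) v = c ^ n • v := by
    intro n
    induction n with
    | zero => simp
    | succ n ih => rw [pow_succ, mul_apply_eq_comp, h, map_smul, ih, smul_smul, pow_succ']
  have h1 := (NormedSpace.exp_series_hasSum_exp' (𝕂 := ℂ) A).mapL (ContinuousLinearMap.apply ℂ H v)
  have h2 := (NormedSpace.exp_series_hasSum_exp' (𝕂 := ℂ) c).smul_const v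
  simp only [map_smul, ContinuousLinearMap.apply_apply, hpow] at h1
  rw [← Complex.exp_eq_exp_ℂ] at h2
  simp only [smul_assoc] at h2
  exact h1.unique h2

theorem phaseOp_apply_of_apply_eq_self {P : H →L[ℂ] H} {v : H} (h : P v = v) (φ : ℝ) :
    phaseOp P φ v = Complex.exp (φ * Complex.I) • v := by
  refine exp_apply_of_apply_eq_smul _ _ _ ?_
  simp only [smul_apply, sub_apply,
    one_apply_eq_self, h]
  module

theorem phaseOp_apply_of_apply_eq_zero {P : H →L[ℂ] H} {v : H} (h : P v = 0) (φ : ℝ) :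
    phaseOp P φ v = Complex.exp (-(φ * Complex.I)) • v := by
  refine exp_apply_of_apply_eq_smul _ _ _ ?_
  simp only [smul_apply, sub_apply,
    one_apply_eq_self, h]
  module

theorem phasedSeq_nil (U P Q : H →L[ℂ] H) : phasedSeq U P Q ([] : List ℝ).get = 1 := by
  simp [phasedSeq]

theorem phasedSeq_cons (U P Q : H →L[ℂ] H) (φ : ℝ) (l : List ℝ) :
    phasedSeq U P Q (φ :: l).get =
      (if Odd (l.length + 1) then phaseOp Q φ * U else phaseOp P φ * star U) *
        phasedSeq U P Q l.get := by
  unfold phasedSeq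
  have h : ∀ (n : ℕ) (f : Fin (n + 1) → H →L[ℂ] H), (List.ofFn f).prod =
      f 0 * (List.ofFn fun i => f i.succ).prod := fun n f => by
    rw [List.ofFn_succ, List.prod_cons]
  refine (h l.length _).trans ?_
  congr 3
  funext i
  simp [Nat.add_sub_add_right]

/-- The phased sequence on the invariant subspace of a pair of singular vectors `v`, `w` with
singular value `x`. -/
theorem phasedSeq_apply_singular_vector {U P Q : H →L[ℂ] H} (hU : U ∈ unitary (H →L[ℂ] H))
    {v w : H} {x : ℝ}
    (hv : P v = v) (hw : Q w = w) (hvw : Q (U v) = (x : ℂ) • w) (hwv : P (star U w) = (x : ℂ) • v)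
    (l : List ℝ) :
    phasedSeq U P Q l.get v = if Odd l.length then
        (qsvAmp x l).1 • w + (qsvAmp x l).2 • (U v - (x : ℂ) • w)
      else (qsvAmp x l).1 • v + (qsvAmp x l).2 • (star U w - (x : ℂ) • v) := by
  have h1 : star U (U v) = v := by
    rw [← mul_apply_eq_comp, (Unitary.mem_iff.1 hU).1, one_apply_eq_self]
  have h2 : U (star U w) = w := by
    rw [← mul_apply_eq_comp, (Unitary.mem_iff.1 hU).2, one_apply_eq_self]
  have ha : Q (U v - (x : ℂ) • w) = 0 := by rw [map_sub, map_smul, hw, hvw, sub_self]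
  have hb : P (star U w - (x : ℂ) • v) = 0 := by rw [map_sub, map_smul, hv, hwv, sub_self]
  -- `U v - x w` and `U†w - x v` are left unnormalised, so no division by `√(1 - x²)` occurs and `x
  -- = 1` needs no separate case.
  induction l with
  | nil => simp [phasedSeq_nil, qsvAmp]
  | cons φ l ih =>
    rw [phasedSeq_cons, mul_apply_eq_comp, ih, List.length_cons]
    simp only [qsvAmp]
    generalize (qsvAmp x l).1 = α
    generalize (qsvAmp x l).2 = β
    by_cases hl : Odd l.length
    · rw [if_pos hl, if_neg (by rw [Nat.odd_add_one]; simpa using hl),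
        if_neg (by rw [Nat.odd_add_one]; simpa using hl), mul_apply_eq_comp]
      have e : star U (α • w + β • (U v - (x : ℂ) • w)) = (x * α + (1 - x ^ 2) * β) • v +
          (α - x * β) • (star U w - (x : ℂ) • v) := by
        rw [map_add, map_smul, map_smul, map_sub, map_smul, h1]
        module
      rw [e, map_add, map_smul, map_smul, phaseOp_apply_of_apply_eq_self hv,
        phaseOp_apply_of_apply_eq_zero hb]
      module
    · rw [if_neg hl, if_pos (by rwa [Nat.odd_add_one]), if_pos (by rwa [Nat.odd_add_one]),
        mul_apply_eq_comp]
      have e : U (α • v + β • (star U w - (x : ℂ) • v)) = (x * α + (1 - x ^ 2) * β) • w +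
          (α - x * β) • (U v - (x : ℂ) • w) := by
        rw [map_add, map_smul, map_smul, map_sub, map_smul, h2]
        module
      rw [e, map_add, map_smul, map_smul, phaseOp_apply_of_apply_eq_self hw,
        phaseOp_apply_of_apply_eq_zero ha]
      module

end Eigen

/-! ### Singular value decompositions and the compressed operator -/

section Diagonal

variable {H : Type*} [NormedAddCommGroup H] [InnerProductSpace ℂ H] {n : ℕ}

theorem diagOp_single (a : Fin n → ℂ) (i : Fin n) :
    diagOp a (EuclideanSpace.single i 1) = a i • EuclideanSpace.single i (1 : ℂ) := by
  ext j
  rw [diagOp, Matrix.ofLp_toEuclideanCLM, Matrix.mulVec_diagonal]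
  by_cases h : j = i <;> simp [h]

theorem conjOp_apply_single (W V : EuclideanSpace ℂ (Fin n) ≃ₗᵢ[ℂ] H) (a : Fin n → ℂ)
    (i : Fin n) : conjOp W (diagOp a) V (V (EuclideanSpace.single i 1)) =
      a i • W (EuclideanSpace.single i 1) := by
  simp [conjOp, diagOp_single]

theorem conjOp_one_apply (W V : EuclideanSpace ℂ (Fin n) ≃ₗᵢ[ℂ] H)
    (x : EuclideanSpace ℂ (Fin n)) : conjOp W 1 V (V x) = W x := by
  simp [conjOp]

theorem clm_ext_of_apply_single (V : EuclideanSpace ℂ (Fin n) ≃ₗᵢ[ℂ] H) {A B : H →L[ℂ] H}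
    (h : ∀ i, A (V (EuclideanSpace.single i 1)) = B (V (EuclideanSpace.single i 1))) : A = B := by
  have : (A : H →ₗ[ℂ] H) = B := by
    refine (((EuclideanSpace.basisFun (Fin n) ℂ).map V).toBasis).ext fun i => ?_
    simpa using h i
  exact ContinuousLinearMap.coe_injective this

theorem star_diagOp (a : Fin n → ℂ) : star (diagOp a) = diagOp (star a) := by
  rw [diagOp, diagOp, ← map_star, Matrix.star_eq_conjTranspose, Matrix.diagonal_conjTranspose]

theorem star_conjOp [CompleteSpace H] (W V : EuclideanSpace ℂ (Fin n) ≃ₗᵢ[ℂ] H)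
    (D : EuclideanSpace ℂ (Fin n) →L[ℂ] EuclideanSpace ℂ (Fin n)) :
    star (conjOp W D V) = conjOp V (star D) W := by
  rw [ContinuousLinearMap.star_eq_adjoint, ContinuousLinearMap.star_eq_adjoint, eq_comm,
    ContinuousLinearMap.eq_adjoint_iff]
  intro x y
  simp only [conjOp, ContinuousLinearMap.comp_apply, ContinuousLinearEquiv.coe_coe,
    LinearIsometryEquiv.coe_toContinuousLinearEquiv]
  rw [LinearIsometryEquiv.inner_map_eq_flip, ContinuousLinearMap.adjoint_inner_left,
    LinearIsometryEquiv.inner_map_eq_flip]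
  simp

theorem norm_conjOp_diagOp_le (W V : EuclideanSpace ℂ (Fin n) ≃ₗᵢ[ℂ] H) (a : Fin n → ℂ) {ε : ℝ}
    (hε : 0 ≤ ε) (ha : ∀ i, ‖a i‖ ≤ ε) : ‖conjOp W (diagOp a) V‖ ≤ ε := by
  have hD : ‖diagOp a‖ ≤ ε := by
    rw [diagOp, Matrix.l2_opNorm_toEuclideanCLM, Matrix.l2_opNorm_diagonal]
    exact (pi_norm_le_iff_of_nonneg hε).2 ha
  refine ContinuousLinearMap.opNorm_le_bound _ hε fun x => ?_
  simp only [conjOp, ContinuousLinearMap.comp_apply, ContinuousLinearEquiv.coe_coe,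
    LinearIsometryEquiv.coe_toContinuousLinearEquiv, LinearIsometryEquiv.norm_map]
  refine (ContinuousLinearMap.le_of_opNorm_le _ hD _).trans ?_
  rw [LinearIsometryEquiv.norm_map]

theorem IsSVD.apply_right {A : H →L[ℂ] H} {W V : EuclideanSpace ℂ (Fin n) ≃ₗᵢ[ℂ] H}
    {σ : Fin n → ℝ} (h : IsSVD A W σ V) (i : Fin n) :
    A (V (EuclideanSpace.single i 1)) = (σ i : ℂ) • W (EuclideanSpace.single i 1) := by
  rw [h.eq, conjOp_apply_single]

end Diagonal

section SVD

variable {H : Type*} [NormedAddCommGroup H] [InnerProductSpace ℂ H] [CompleteSpace H] {n : ℕ}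

theorem IsStarProjection.apply_apply {P : H →L[ℂ] H} (hP : IsStarProjection P) (x : H) :
    P (P x) = P x := by
  rw [← mul_apply_eq_comp, hP.isIdempotentElem.eq]

theorem IsSVD.star {A : H →L[ℂ] H} {W V : EuclideanSpace ℂ (Fin n) ≃ₗᵢ[ℂ] H}
    {σ : Fin n → ℝ} (h : IsSVD A W σ V) : IsSVD (star A) V σ W where
  nonneg := h.nonneg
  antitone := h.antitone
  eq := by
    rw [h.eq, star_conjOp, star_diagOp]
    congr 2
    funext i
    simp

variable {U P Q : H →L[ℂ] H} {W V : EuclideanSpace ℂ (Fin n) ≃ₗᵢ[ℂ] H} {σ : Fin n → ℝ}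

theorem IsSVD.star_compression (hP : IsStarProjection P) (hQ : IsStarProjection Q)
    (h : IsSVD (Q * U * P) W σ V) : IsSVD (P * Star.star U * Q) V σ W := by
  have := h.star
  rwa [star_mul, star_mul, hP.isSelfAdjoint.star_eq, hQ.isSelfAdjoint.star_eq, ← mul_assoc] at this

theorem IsSVD.proj_left (hQ : IsStarProjection Q) (h : IsSVD (Q * U * P) W σ V) {i : Fin n}
    (hi : 0 < σ i) : Q (W (EuclideanSpace.single i 1)) = W (EuclideanSpace.single i 1) := by
  have h1 := h.apply_right i
  have h2 : (σ i : ℂ) ≠ 0 := Complex.ofReal_ne_zero.2 hi.ne'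
  have h3 : W (EuclideanSpace.single i 1) =
      (σ i : ℂ)⁻¹ • (Q * U * P) (V (EuclideanSpace.single i 1)) := by
    rw [h1, smul_smul, inv_mul_cancel₀ h2, one_smul]
  rw [h3, map_smul, mul_apply_eq_comp, mul_apply_eq_comp, hQ.apply_apply]

theorem IsSVD.proj_right (hP : IsStarProjection P) (hQ : IsStarProjection Q)
    (h : IsSVD (Q * U * P) W σ V) {i : Fin n} (hi : 0 < σ i) :
    P (V (EuclideanSpace.single i 1)) = V (EuclideanSpace.single i 1) :=
  (h.star_compression hP hQ).proj_left hP hi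

theorem IsSVD.apply_unitary (hP : IsStarProjection P) (hQ : IsStarProjection Q)
    (h : IsSVD (Q * U * P) W σ V) {i : Fin n} (hi : 0 < σ i) :
    Q (U (V (EuclideanSpace.single i 1))) = (σ i : ℂ) • W (EuclideanSpace.single i 1) := by
  rw [← h.apply_right i, mul_apply_eq_comp, mul_apply_eq_comp,
    h.proj_right hP hQ hi]

theorem IsSVD.singular_value_le_one (hU : U ∈ unitary (H →L[ℂ] H)) (hP : IsStarProjection P)
    (hQ : IsStarProjection Q) (h : IsSVD (Q * U * P) W σ V) (i : Fin n) : σ i ≤ 1 := by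
  have h1 := congrArg norm (h.apply_right i)
  rw [norm_smul, LinearIsometryEquiv.norm_map, PiLp.norm_single, norm_one, mul_one,
    Complex.norm_real, Real.norm_of_nonneg (h.nonneg i)] at h1
  rw [← h1]
  have h2 : ‖Q * U * P‖ ≤ 1 := by
    calc ‖Q * U * P‖ ≤ ‖Q * U‖ * ‖P‖ := norm_mul_le _ _
      _ = ‖Q‖ * ‖P‖ := by rw [CStarRing.norm_mul_mem_unitary Q hU]
      _ ≤ 1 * 1 := by
          gcongr
          · exact IsStarProjection.norm_le Q hQ
          · exact IsStarProjection.norm_le P hP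
      _ = 1 := by norm_num
  refine (ContinuousLinearMap.le_of_opNorm_le _ h2 _).trans ?_
  simp

/-- `P` is absorbed by the threshold projector on singular vectors in its range. -/
theorem threshProj_eq_conjOp (hP : IsStarProjection P) (S : Set ℝ)
    (h : ∀ i, σ i ∈ S → P (V (EuclideanSpace.single i 1)) = V (EuclideanSpace.single i 1)) :
    threshProj P V σ S = conjOp V (sigmaSet σ S) V := by
  have h1 : P * conjOp V (sigmaSet σ S) V = conjOp V (sigmaSet σ S) V := by
    refine clm_ext_of_apply_single V fun i => ?_
    rw [mul_apply_eq_comp, sigmaSet, conjOp_apply_single, map_smul]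
    by_cases hi : σ i ∈ S
    · rw [h i hi]
    · simp [hi]
  have hs : Star.star (conjOp V (sigmaSet σ S) V) = conjOp V (sigmaSet σ S) V := by
    rw [star_conjOp, sigmaSet, star_diagOp]
    congr 2
    funext i
    by_cases hi : σ i ∈ S <;> simp [hi]
  have h2 : conjOp V (sigmaSet σ S) V * P = conjOp V (sigmaSet σ S) V := by
    have := congrArg Star.star h1
    rwa [star_mul, hP.isSelfAdjoint.star_eq, hs] at this
  rw [threshProj, h1, h2]

theorem norm_threshProj_mul_phasedSeq_sub_le (hU : U ∈ unitary (H →L[ℂ] H))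
    (hP : IsStarProjection P) (hQ : IsStarProjection Q) (h : IsSVD (Q * U * P) W σ V)
    {δ ε : ℝ} (hδ : 0 < δ) (hε : 0 ≤ ε) (l : List ℝ) (hl : Odd l.length)
    (hamp : ∀ x : ℝ, δ ≤ x → x ≤ 1 → ‖(qsvAmp x l).1 - 1‖ ≤ ε) :
    ‖threshProj Q W σ (Set.Ici δ) * phasedSeq U P Q l.get * threshProj P V σ (Set.Ici δ) -
      threshProj Q W σ (Set.Ici δ) * conjOp W 1 V * threshProj P V σ (Set.Ici δ)‖ ≤ ε := by
  have hpos : ∀ i, σ i ∈ Set.Ici δ → 0 < σ i := fun i hi => hδ.trans_le hi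
  have hTP := threshProj_eq_conjOp (V := V) hP (Set.Ici δ) fun i hi =>
    h.proj_right hP hQ (hpos i hi)
  have hTQ := threshProj_eq_conjOp (V := W) hQ (Set.Ici δ) fun i hi => h.proj_left hQ (hpos i hi)
  have hTQ0 : ∀ y, Q y = 0 → threshProj Q W σ (Set.Ici δ) y = 0 := fun y hy => by
    rw [threshProj, mul_apply_eq_comp, hy, map_zero]
  have hTQ1 : ∀ i, σ i ∈ Set.Ici δ → threshProj Q W σ (Set.Ici δ) (W (EuclideanSpace.single i 1)) =
      W (EuclideanSpace.single i 1) := fun i hi => by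
    rw [hTQ, sigmaSet, conjOp_apply_single]; simp [hi]
  -- Checked on the right singular vectors: the second amplitude multiplies `U v - x w`, which `Q`
  -- kills.
  have key : threshProj Q W σ (Set.Ici δ) * phasedSeq U P Q l.get * threshProj P V σ (Set.Ici δ) -
      threshProj Q W σ (Set.Ici δ) * conjOp W 1 V * threshProj P V σ (Set.Ici δ) =
      conjOp W (diagOp fun i =>
        (Set.Ici δ).indicator (fun x => (qsvAmp x l).1 - 1) (σ i)) V := by
    refine clm_ext_of_apply_single V fun i => ?_
    rw [conjOp_apply_single, sub_apply]
    simp only [mul_apply_eq_comp]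
    rw [hTP, sigmaSet, conjOp_apply_single]
    by_cases hi : σ i ∈ Set.Ici δ
    · rw [Set.indicator_of_mem hi, Set.indicator_of_mem hi, one_smul, conjOp_one_apply, hTQ1 i hi,
        phasedSeq_apply_singular_vector hU (h.proj_right hP hQ (hpos i hi))
          (h.proj_left hQ (hpos i hi)) (h.apply_unitary hP hQ (hpos i hi))
          ((h.star_compression hP hQ).apply_unitary hQ hP (hpos i hi)), if_pos hl, map_add,
        map_smul, map_smul, hTQ1 i hi, hTQ0, smul_zero, add_zero, sub_smul, one_smul]
      rw [map_sub, map_smul, h.apply_unitary hP hQ (hpos i hi), h.proj_left hQ (hpos i hi),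
        sub_self]
    · rw [Set.indicator_of_notMem hi, Set.indicator_of_notMem hi]
      simp
  rw [key]
  refine norm_conjOp_diagOp_le _ _ _ hε fun i => ?_
  by_cases hi : σ i ∈ Set.Ici δ
  · rw [Set.indicator_of_mem hi]
    exact hamp _ hi (h.singular_value_le_one hU hP hQ i)
  · rw [Set.indicator_of_notMem hi, norm_zero]
    exact hε

end SVD

/-! ### Circuits with one ancilla qubit -/

theorem pauliX_ket0 : Matrix.toEuclideanLin !![(0 : ℂ), 1; 1, 0] ket0 =
    (EuclideanSpace.single 1 1 : Qubit) := by
  ext i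
  fin_cases i <;> simp [ket0, Matrix.toLpLin_apply]

theorem pauliX_ket1 : Matrix.toEuclideanLin !![(0 : ℂ), 1; 1, 0]
    (EuclideanSpace.single 1 1 : Qubit) = ket0 := by
  ext i
  fin_cases i <;> simp [ket0, Matrix.toLpLin_apply]

/-- The gate `e^{-iφZ}`. -/
noncomputable def zRotation (φ : ℝ) : Matrix.unitaryGroup (Fin 2) ℂ :=
  ⟨Matrix.diagonal ![Complex.exp (-(φ * Complex.I)), Complex.exp (φ * Complex.I)], by
    rw [Matrix.mem_unitaryGroup_iff, Matrix.star_eq_conjTranspose,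
      Matrix.diagonal_conjTranspose, Matrix.diagonal_mul_diagonal, ← Matrix.diagonal_one]
    congr 1
    funext i
    fin_cases i <;> simp [← Complex.exp_conj, ← Complex.exp_add]⟩

theorem zRotation_ket0 (φ : ℝ) :
    Matrix.toEuclideanLin (zRotation φ : Matrix (Fin 2) (Fin 2) ℂ) ket0 =
      Complex.exp (-(φ * Complex.I)) • ket0 := by
  ext i
  fin_cases i <;>
    simp [ket0, zRotation, Matrix.toLpLin_apply]

theorem zRotation_ket1 (φ : ℝ) :
    Matrix.toEuclideanLin (zRotation φ : Matrix (Fin 2) (Fin 2) ℂ)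
      (EuclideanSpace.single 1 1 : Qubit) =
      Complex.exp (φ * Complex.I) • (EuclideanSpace.single 1 1 : Qubit) := by
  ext i
  fin_cases i <;>
    simp [zRotation, Matrix.toLpLin_apply]

section Circuit

variable {H : Type*} [NormedAddCommGroup H] [InnerProductSpace ℂ H] {U P Q : H →L[ℂ] H}

theorem cProjNot_tmul_of_apply_eq_self {y : H} (h : P y = y) (k : Qubit) :
    cProjNot P (k ⊗ₜ[ℂ] y) = Matrix.toEuclideanLin !![(0 : ℂ), 1; 1, 0] k ⊗ₜ[ℂ] y := by
  simp [cProjNot, h]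

theorem cProjNot_tmul_of_apply_eq_zero {y : H} (h : P y = 0) (k : Qubit) :
    cProjNot P (k ⊗ₜ[ℂ] y) = k ⊗ₜ[ℂ] y := by
  simp [cProjNot, h]

variable [CompleteSpace H]

theorem Implements.append {c₁ c₂ : List Gate} {T₁ T₂ : H →L[ℂ] H} (h₁ : Implements U P Q c₁ T₁)
    (h₂ : Implements U P Q c₂ T₂) : Implements U P Q (c₁ ++ c₂) (T₁ * T₂) := by
  intro ψ
  have h : circuitOp U P Q (c₁ ++ c₂) (ket0 ⊗ₜ[ℂ] ψ) =
      circuitOp U P Q c₁ (circuitOp U P Q c₂ (ket0 ⊗ₜ[ℂ] ψ)) := by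
    simp only [circuitOp, List.map_append, List.prod_append, Module.End.mul_apply]
  rw [h, h₂ ψ, h₁ (T₂ ψ), mul_apply_eq_comp]

theorem implements_nil : Implements U P Q [] 1 := fun ψ => by
  simp [circuitOp]

theorem implements_applyU : Implements U P Q [.applyU] U := fun ψ => by
  simp [circuitOp, Gate.op]

theorem implements_applyUdag : Implements U P Q [.applyUdag] (star U) := fun ψ => by
  simp [circuitOp, Gate.op]

theorem implements_single_one : Implements U P Q [.single 1] 1 := fun ψ => by
  simp [circuitOp, Gate.op, Matrix.toLpLin_one]

/-- On the range of `P` the ancilla is flipped, receives `e^{iφ}` and is flipped back; on the kernel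
it stays in `|0⟩` and receives `e^{-iφ}`. -/
theorem cProjNot_zRotation_cProjNot (hP : IsStarProjection P) (φ : ℝ) (ψ : H) :
    cProjNot P (TensorProduct.map
      (Matrix.toEuclideanLin (zRotation φ : Matrix (Fin 2) (Fin 2) ℂ)) LinearMap.id
      (cProjNot P (ket0 ⊗ₜ[ℂ] ψ))) = ket0 ⊗ₜ[ℂ] phaseOp P φ ψ := by
  have h1 : P (P ψ) = P ψ := hP.apply_apply ψ
  have h2 : P (ψ - P ψ) = 0 := by rw [map_sub, h1, sub_self]
  have e : ψ = P ψ + (ψ - P ψ) := by abel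
  rw [e]
  generalize P ψ = a at h1 h2
  generalize ψ - a = b at h2
  simp only [TensorProduct.tmul_add, map_add]
  congr 1
  · rw [cProjNot_tmul_of_apply_eq_self h1, pauliX_ket0, TensorProduct.map_tmul, zRotation_ket1,
      LinearMap.id_apply, cProjNot_tmul_of_apply_eq_self h1, map_smul, pauliX_ket1,
      phaseOp_apply_of_apply_eq_self h1, TensorProduct.smul_tmul]
  · rw [cProjNot_tmul_of_apply_eq_zero h2, TensorProduct.map_tmul, zRotation_ket0,
      LinearMap.id_apply, cProjNot_tmul_of_apply_eq_zero h2,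
      phaseOp_apply_of_apply_eq_zero h2, TensorProduct.smul_tmul]

theorem implements_phaseOp_left (hP : IsStarProjection P) (φ : ℝ) :
    Implements U P Q [.cNotP, .single (zRotation φ), .cNotP] (phaseOp P φ) := fun ψ => by
  rw [← cProjNot_zRotation_cProjNot hP]
  simp [circuitOp, Gate.op]

theorem implements_phaseOp_right (hQ : IsStarProjection Q) (φ : ℝ) :
    Implements U P Q [.cNotQ, .single (zRotation φ), .cNotQ] (phaseOp Q φ) := fun ψ => by
  rw [← cProjNot_zRotation_cProjNot hQ]
  simp [circuitOp, Gate.op]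

/-- Each phase uses two controlled NOTs of its own kind. For odd length the bound for `Q` is one
above the length, an excess that the main theorem avoids by a vanishing first phase. -/
theorem exists_circuit_phasedSeq (hP : IsStarProjection P) (hQ : IsStarProjection Q)
    (l : List ℝ) : ∃ c : List Gate, Implements U P Q c (phasedSeq U P Q l.get) ∧
      (c.map Gate.usesU).sum = l.length ∧ (c.map Gate.usesCP).sum ≤ 2 * (l.length / 2) ∧
      (c.map Gate.usesCQ).sum ≤ 2 * ((l.length + 1) / 2) ∧
      (c.map Gate.usesSingle).sum = l.length := by
  induction l with
  | nil => exact ⟨[], by rw [phasedSeq_nil]; exact implements_nil, by simp⟩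
  | cons φ l ih =>
    obtain ⟨c, hc, h1, h2, h3, h4⟩ := ih
    by_cases hl : Odd (l.length + 1)
    · refine ⟨[.cNotQ, .single (zRotation φ), .cNotQ] ++ [.applyU] ++ c, ?_, ?_⟩
      · rw [phasedSeq_cons, if_pos hl]
        exact ((implements_phaseOp_right hQ φ).append implements_applyU).append hc
      · obtain ⟨k, hk⟩ := hl
        simp only [List.map_append, List.sum_append, List.map_cons, List.map_nil, List.sum_cons,
          List.sum_nil, Gate.usesU, Gate.usesCP, Gate.usesCQ, Gate.usesSingle, List.length_cons]
        omega
    · refine ⟨[.cNotP, .single (zRotation φ), .cNotP] ++ [.applyUdag] ++ c, ?_, ?_⟩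
      · rw [phasedSeq_cons, if_neg hl]
        exact ((implements_phaseOp_left hP φ).append implements_applyUdag).append hc
      · rw [Nat.not_odd_iff_even] at hl
        obtain ⟨k, hk⟩ := hl
        simp only [List.map_append, List.sum_append, List.map_cons, List.map_nil, List.sum_cons,
          List.sum_nil, Gate.usesU, Gate.usesCP, Gate.usesCQ, Gate.usesSingle, List.length_cons]
        omega

end Circuit

/-! ### Assembly -/

open Polynomial in
/-- An odd polynomial in `cos θ` of degree at most `2e + 1` is a Laurent polynomial in `e^{iθ}`. -/
theorem exists_poly_sq_exp (e : ℕ) (G : ℝ[X]) (hG : G.natDegree ≤ e) :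
    ∃ p : ℝ[X], p.natDegree ≤ 2 * e + 1 ∧ ∀ θ : ℝ,
      aeval (Complex.exp (θ * Complex.I) ^ 2) p = Complex.exp (θ * Complex.I) ^ (2 * e + 1) *
        ((Real.cos θ * G.eval (Real.cos θ ^ 2) : ℝ) : ℂ) := by
  -- From `z cos θ = (z² + 1)/2`: the monomial `cos^{2i+1} θ` uses `2i + 1` of the powers of `z`,
  -- and `(z²)^{e-i}` remains.
  refine ⟨∑ i ∈ Finset.range (e + 1),
    C (G.coeff i) * X ^ (e - i) * (C (1 / 2) * (X + 1)) ^ (2 * i + 1), ?_, fun θ => ?_⟩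
  · refine natDegree_sum_le_of_forall_le _ _ fun i hi => ?_
    have hi' : i ≤ e := by simpa [Nat.lt_succ_iff] using hi
    have h1 : (C (1 / 2) * (X + 1) : ℝ[X]).natDegree ≤ 1 := by compute_degree
    have h2 := (natDegree_pow_le_of_le (2 * i + 1) h1)
    have h3 := natDegree_C_mul_X_pow_le (G.coeff i) (e - i)
    refine natDegree_mul_le.trans ?_
    omega
  · set z := Complex.exp (θ * Complex.I) with hz
    have hcos : z * (Real.cos θ : ℂ) = 1 / 2 * (z ^ 2 + 1) := by
      have h1 : z * Complex.exp (-(θ * Complex.I)) = 1 := by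
        rw [hz, ← Complex.exp_add, add_neg_cancel, Complex.exp_zero]
      rw [Complex.ofReal_cos, Complex.cos, ← hz, neg_mul]
      linear_combination h1 / 2
    rw [eval_eq_sum_range' (Nat.lt_succ_of_le hG), map_sum, Finset.mul_sum, Complex.ofReal_sum,
      Finset.mul_sum]
    refine Finset.sum_congr rfl fun i hi => ?_
    have hi' : i ≤ e := by simpa [Nat.lt_succ_iff] using hi
    have h12 : ((1 / 2 : ℝ) : ℂ) = 1 / 2 := by push_cast; rfl
    simp only [map_mul, map_pow, map_add, map_one, aeval_C, aeval_X, Complex.coe_algebraMap, h12]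
    rw [← hcos, mul_pow]
    have he : z ^ (2 * e + 1) = (z ^ 2) ^ (e - i) * z ^ (2 * i + 1) := by
      rw [← pow_mul, ← pow_add]; congr 1; omega
    rw [he]
    push_cast
    ring

theorem exp_mul_I_sq (θ : ℝ) :
    Complex.exp (θ * Complex.I) ^ 2 = Complex.exp ((2 * θ : ℝ) * Complex.I) := by
  rw [← Complex.exp_nat_mul]
  congr 1
  push_cast
  ring

open Polynomial in
/-- A bounded real odd polynomial `x G(x²)` is the real part of an amplitude of the alternating
phase sequence. The first phase can be taken to vanish. -/
theorem exists_phases_of_odd_poly (e : ℕ) (G : ℝ[X]) (hG : G.natDegree ≤ e)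
    (hb : ∀ x : ℝ, 0 ≤ x → x ≤ 1 → 0 ≤ x * G.eval (x ^ 2) ∧ x * G.eval (x ^ 2) ≤ 1) :
    ∃ l : List ℝ, l.length = 2 * e + 2 ∧ ∀ x : ℝ, 0 ≤ x → x ≤ 1 →
      (qsvAmp x (0 :: l)).1.re = x * G.eval (x ^ 2) ∧ ‖(qsvAmp x (0 :: l)).1‖ ≤ 1 := by
  obtain ⟨p, hp, hpe⟩ := exists_poly_sq_exp e G hG
  -- `Y` sends `cos θ` to `cos²(θ/2)`, so `1 - Y * G.comp Y ^ 2` at `cos θ` is `1 - |p|²` at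
  -- `e^{iθ}`.
  set Y : ℝ[X] := C (1 / 2) * (X + 1) with hY
  have hYd : Y.natDegree ≤ 1 := by rw [hY]; compute_degree
  have hRe : ∀ t : ℝ, (1 - Y * G.comp Y ^ 2).eval t =
      1 - (1 + t) / 2 * G.eval ((1 + t) / 2) ^ 2 := fun t => by
    have : Y.eval t = (1 + t) / 2 := by simp [hY]; ring
    simp [eval_comp, this]
  obtain ⟨h, hh, hhe⟩ := exists_spectral_factor (2 * e + 1) (1 - Y * G.comp Y ^ 2) (by
    refine (natDegree_sub_le _ _).trans (max_le (by simp) (natDegree_mul_le.trans ?_))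
    have h1 : (G.comp Y).natDegree ≤ e := by
      rw [natDegree_comp]
      calc _ ≤ e * 1 := Nat.mul_le_mul hG hYd
        _ = e := mul_one e
    have h2 := natDegree_pow_le_of_le 2 h1
    omega) (fun t ht => by
    rw [hRe]
    have h0 : 0 ≤ (1 + t) / 2 := by linarith [ht.1]
    obtain ⟨h1, h2⟩ := hb √((1 + t) / 2) (Real.sqrt_nonneg _)
      (Real.sqrt_le_one.2 (by linarith [ht.2]))
    have h3 := mul_le_one₀ h2 h1 h2
    rw [Real.sq_sqrt h0] at h3
    have h4 : √((1 + t) / 2) ^ 2 = (1 + t) / 2 := Real.sq_sqrt h0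
    nlinarith)
  have hcirc : ∀ θ : ℝ, Complex.normSq (aeval (Complex.exp (θ * Complex.I)) p) +
      Complex.normSq (aeval (Complex.exp (θ * Complex.I)) h) = 1 := by
    intro θ
    have h1 := hpe (θ / 2)
    rw [exp_mul_I_sq, mul_div_cancel₀ θ two_ne_zero] at h1
    rw [hhe, h1, map_mul, map_pow, normSq_exp_mul_I, one_pow, one_mul, Complex.normSq_ofReal, hRe]
    have h2 : (1 + Real.cos θ) / 2 = Real.cos (θ / 2) ^ 2 := by
      rw [Real.cos_sq, mul_div_cancel₀ θ two_ne_zero]; ring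
    rw [h2]
    ring
  obtain ⟨μ, l, hl, hphase⟩ := exists_phases_of_normSq_add_eq_one (2 * e + 1) p h hp hh hcirc
  obtain ⟨ψ, l', rfl⟩ : ∃ ψ l', l = ψ :: l' := List.exists_cons_of_length_eq_add_one hl
  set κ := Complex.I ^ (2 * e + 1) * Complex.exp ((Real.pi / 4 : ℝ) * Complex.I) with hκ
  -- The innermost phase absorbs both the outermost phase `ψ` and the normalisation `κ`, so that the
  -- new amplitude is exactly `P`. As `p(z²)/z^{2e+1}` is real, its real part is the prescribed
  -- polynomial.
  set ν : ℝ := ψ + (2 * e + 1 : ℕ) * (Real.pi / 2) + Real.pi / 4 with hν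
  have hν' : Complex.exp (ν * Complex.I) = κ * Complex.exp (ψ * Complex.I) := by
    have hI : Complex.I ^ (2 * e + 1) =
        Complex.exp (((2 * e + 1 : ℕ) : ℂ) * ((Real.pi / 2 : ℝ) * Complex.I)) := by
      rw [Complex.exp_nat_mul]
      push_cast
      rw [Complex.exp_pi_div_two_mul_I]
    rw [hκ, hI, ← Complex.exp_add, ← Complex.exp_add, hν]
    congr 1
    push_cast
    ring
  refine ⟨l' ++ [μ + ν, 0], by simp at hl ⊢; omega, fun x hx0 hx1 => ?_⟩
  have hamp : (qsvAmp x (0 :: (l' ++ [μ + ν, 0]))).1 =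
      κ * (qsvAmp x (ψ :: l' ++ [μ, 0])).1 := by
    simp only [List.cons_append, qsvAmp, qsvAmp_append, hν']
    simp
    ring
  obtain ⟨h1, h2⟩ := hphase (Real.arccos x) _ _ _ rfl rfl rfl
  rw [Real.cos_arccos (by linarith) hx1, ← hamp] at h1 h2
  have hc := hcirc (2 * Real.arccos x)
  rw [← exp_mul_I_sq, h1, h2] at hc
  rw [hpe, Real.cos_arccos (by linarith) hx1] at h1
  have h3 := mul_left_cancel₀ (pow_ne_zero _ (Complex.exp_ne_zero _)) h1
  generalize (qsvAmp x (0 :: (l' ++ [μ + ν, 0]))).1 = A at h3 hc ⊢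
  simp only [map_mul, map_pow, normSq_exp_mul_I, one_pow, one_mul] at hc
  constructor
  · have := congrArg Complex.re h3
    simpa using this.symm
  · rw [← sq_le_one_iff₀ (norm_nonneg _), ← Complex.normSq_eq_norm_sq, Complex.normSq_apply]
    simp [Complex.normSq_apply] at hc
    nlinarith [sq_nonneg (Real.sin (Real.arccos x))]

/-- `|w - 1|² = |w|² - 2 Re w + 1 ≤ 2 - 2 Re w`. -/
theorem norm_sub_one_le_of_re {w : ℂ} {ε : ℝ} (hε : 0 ≤ ε) (hw : ‖w‖ ≤ 1)
    (hre : 1 - ε ^ 2 / 2 ≤ w.re) : ‖w - 1‖ ≤ ε := by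
  rw [← sq_le_sq₀ (norm_nonneg _) hε, ← Complex.normSq_eq_norm_sq, Complex.normSq_apply]
  have h1 : ‖w‖ ^ 2 ≤ 1 := pow_le_one₀ (norm_nonneg _) hw
  rw [← Complex.normSq_eq_norm_sq, Complex.normSq_apply] at h1
  simp only [Complex.sub_re, Complex.sub_im, Complex.one_re, Complex.one_im]
  nlinarith

theorem threshProj_eq_zero {H : Type*} [NormedAddCommGroup H] [InnerProductSpace ℂ H] {n : ℕ}
    (P : H →L[ℂ] H) (V : EuclideanSpace ℂ (Fin n) ≃ₗᵢ[ℂ] H) (σ : Fin n → ℝ) (S : Set ℝ)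
    (h : ∀ i, σ i ∉ S) : threshProj P V σ S = 0 := by
  have h1 : (fun i => S.indicator (fun _ => (1 : ℂ)) (σ i)) = 0 := by
    funext i; simp [h i]
  rw [threshProj, sigmaSet, h1]
  simp [conjOp, diagOp]

theorem mainTheorem6 :
    ∃ C : ℝ, 0 < C ∧
      ∀ (H : Type*) [NormedAddCommGroup H] [InnerProductSpace ℂ H] [FiniteDimensional ℂ H]
        [CompleteSpace H] (U P Q : H →L[ℂ] H),
        U ∈ unitary (H →L[ℂ] H) → IsStarProjection P → IsStarProjection Q →
      ∀ (δ ε : ℝ), 0 < δ → 0 < ε → ε < 1 / 2 →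
      ∀ (n : ℕ) (W V : EuclideanSpace ℂ (Fin n) ≃ₗᵢ[ℂ] H) (σ : Fin n → ℝ),
        IsSVD (Q * U * P) W σ V →
      ∃ (m : ℕ) (Φ : Fin m → ℝ),
        (m : ℝ) ≤ C * (Real.log (1 / ε) / δ) ∧
        ‖threshProj Q W σ (Set.Ici δ) * phasedSeq U P Q Φ * threshProj P V σ (Set.Ici δ) -
            threshProj Q W σ (Set.Ici δ) * conjOp W 1 V * threshProj P V σ (Set.Ici δ)‖ ≤ ε ∧
        ∃ c : List Gate,
          Implements U P Q c (phasedSeq U P Q Φ) ∧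
          (c.map Gate.usesU).sum = m ∧
          (c.map Gate.usesCP).sum ≤ m ∧
          (c.map Gate.usesCQ).sum ≤ m ∧
          (c.map Gate.usesSingle).sum = m := by
  refine ⟨1100, by norm_num, ?_⟩
  intro H _ _ _ _ U P Q hU hP hQ δ ε hδ hε hε2 n W V σ h
  rcases lt_or_ge 1 δ with hδ1 | hδ1
  -- All singular values are at most `1 < δ`, so both threshold projectors vanish and `m = 0` works.
  · have hz : ∀ i, σ i ∉ Set.Ici δ := fun i hi =>
      absurd (h.singular_value_le_one hU hP hQ i) (not_le.2 (hδ1.trans_le hi))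
    obtain ⟨c, h1, h2, h3, h4, h5⟩ := exists_circuit_phasedSeq (U := U) hP hQ []
    refine ⟨_, ([] : List ℝ).get, ?_, ?_, c, h1, h2, h3, h4, h5⟩
    · have : 0 ≤ Real.log (1 / ε) := Real.log_nonneg (by rw [le_div_iff₀ hε]; linarith)
      rw [List.length_nil, Nat.cast_zero]
      positivity
    · rw [threshProj_eq_zero Q W σ _ hz]
      simpa using hε.le
  · obtain ⟨e, G, hG, hdeg, hb, hs⟩ := exists_sign_poly δ ε hδ hδ1 hε hε2
    obtain ⟨l, hl, hamp⟩ := exists_phases_of_odd_poly e G hG hb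
    obtain ⟨c, h1, h2, h3, h4, h5⟩ := exists_circuit_phasedSeq (U := U) hP hQ l
    have hlen : ((0 : ℝ) :: l).length = 2 * e + 3 := by rw [List.length_cons, hl]
    have hodd : Odd ((0 : ℝ) :: l).length := ⟨e + 1, by rw [hlen]; ring⟩
    -- The outermost phase operator is the identity and needs no controlled NOT; the trivial gate
    -- `.single 1` brings the single-qubit gate count to exactly `m = 2e + 3`.
    refine ⟨_, ((0 : ℝ) :: l).get, ?_, ?_, [.single 1] ++ [.applyU] ++ c, ?_, ?_⟩
    · rw [hlen]; exact hdeg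
    · refine norm_threshProj_mul_phasedSeq_sub_le hU hP hQ h hδ hε.le _ hodd fun x hx0 hx1 => ?_
      obtain ⟨ha, hb'⟩ := hamp x (hδ.le.trans hx0) hx1
      exact norm_sub_one_le_of_re hε.le hb' (ha ▸ hs x hx0 hx1)
    · rw [phasedSeq_cons, if_pos (by simpa using hodd), phaseOp_zero]
      exact (implements_single_one.append implements_applyU).append h1
    · simp only [List.map_append, List.sum_append, List.map_cons, List.map_nil, List.sum_cons,
        List.sum_nil, Gate.usesU, Gate.usesCP, Gate.usesCQ, Gate.usesSingle, List.length_cons]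
      omega
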